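/- Let $\mathbb T=\mathbb R/2\pi\mathbb Z$. For $0<\alpha<\tfrac12$ let $\mathcal L_\alpha$ be the Fourier multiplier $\mathcal L_\alpha f(x)=\sum_{k\in\mathbb Z} i k|k|^{2\alpha-1}\hat f_k e^{ikx}$, where $\hat f_k=\frac1{2\pi}\int_{\mathbb T}f(x)e^{-ikx}\,dx$ (the term $k=0$ is $0$). Fix an even $\psi\in C_c^\infty(\mathbb R)$ with $\psi=1$ on $\{|\xi|<\frac34\}$ and $\operatorname{supp}\psi\subset\{|\xi|<1\}$. Put $\psi_{-1}=\psi$ and $\psi_q(\xi)=\psi(2^{-q-1}\xi)-\psi(2^{-q}\xi)$ for integers $q\ge 0$, $\Delta_q f=\sum_{k\in\mathbb Z}\psi_q(k)\hat f_ke^{ikx}$, and $|f|_{B^s_{r,1}}=\sum_{q\ge-1}2^{qs}|\Delta_qf|_{L^r(\mathbb T)}$. For $T>0$ consider on $\mathbb T\times[0,T]$ the model equation $$\partial_t f=\mathcal L_\alpha\overline f+F_t,\qquad f|_{t=0}=f_0, \tag{M}$$ where $f$ is real-valued, $f\mapsto\overline f$ is a given map on time-dependent $L^1(\mathbb T)$-valued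 functions, and, for each $t$, $F_t:C^\infty(\mathbb T)\to\mathbb R$ is a given linear functional. A function $f\in L^\infty(0,T;L^1(\mathbb T))$, with $f(\cdot,t)\in L^1(\mathbb T)$ defined for every $t\in[0,T]$, is a weak solution of (M) on $[0,T]$ if $t\mapsto\int_{\mathbb T}f(\cdot,t)\varphi\,dx$ is continuous on $[0,T]$ for every $\varphi\in C^\infty(\mathbb T)$, and for every $\varphi\in C^\infty(\mathbb T\times\mathbb R)$ $$\int_{\mathbb T}f(\cdot,T)\varphi(\cdot,T)\,dx-\int_{\mathbb T}f_0\,\varphi(\cdot,0)\,dx=\int_0^T\!\!\int_{\mathbb T}\bigl(f\,\partial_t\varphi-\overline f\,\mathcal L_\alpha\varphi\bigr)\,dx\,dt+\int_0^TF_t(\varphi(\cdot,t))\,dt,$$ where it is part of the definition that $\overline f\in L^1(0,T;L^1(\mathbb T))$ and that $t\mapsto F_t(\varphi(\cdot,t))$ is integrable on $[0,T]$ for every such $\varphi$. For $p\in[1,\infty]$ with Hölder conjugate $p'$ and $\delta>0$, the $(L^p,\delta)$-assumptions on (M) are: (A1) for every $f\in L^\infty(0,T;L^1(\mathbb T))$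 with $\sup_{0\le t\le t_1}|f(\cdot,t)|_{L^p}<\infty$ for some $t_1>0$, there are $C$ and $t_0>0$ (which may depend on $f$) with $|f(\cdot,t)-\overline f(\cdot,t)|_{L^p(\mathbb T)}\le C\,t^\delta$ for all $t\in[0,t_0]$; (A2) there is $C$ with $|F_t(\varphi)|\le C\,|\varphi|_{B^{2\alpha-\delta}_{p',1}}$ for all $\varphi\in C^\infty(\mathbb T)$ and all $t\in[0,T]$. **Proposition 6.3.** For any $0<\alpha<\frac12$, $2<p\le\infty$ and $\delta>0$ there exists an even real-valued $f_0\in L^p(\mathbb T)$ such that the following holds. For every $T>0$ and every model equation (M) on $[0,T]$ satisfying (A1) and (A2), every weak solution $f$ of (M) on $[0,T]$ with initial data $f_0$ satisfies $$\sup_{t\in[0,S]}|f(\cdot,t)|_{L^p(\mathbb T)}=\infty\qquad\text{for every }0<S\le T.$$ -/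

import Mathlib

open MeasureTheory Set
open scoped ENNReal NNReal ContDiff

noncomputable section

namespace DispersiveModel

/-- The torus `ℝ / 2πℤ`, with Lebesgue measure of total mass `2π`. -/
abbrev Torus : Type := AddCircle (2 * Real.pi)

instance : Fact (0 < 2 * Real.pi) := ⟨Real.two_pi_pos⟩

/-- The Banach space `L¹(𝕋)` of real-valued integrable functions. -/
abbrev L1 : Type := Lp ℝ 1 (volume : Measure Torus)

/-- The space `C^∞(𝕋)`: functions on the torus whose `2π`-periodic lift to `ℝ` is smooth. -/
def smoothTorus : Submodule ℝ (Torus → ℝ) where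
  carrier := {φ | ContDiff ℝ ∞ (fun x : ℝ => φ (x : Torus))}
  zero_mem' := by
    rw [mem_ofPred_eq]
    exact contDiff_const
  add_mem' := by
    intro f g hf hg
    rw [mem_ofPred_eq] at *
    exact ContDiff.add hf hg
  smul_mem' := by
    intro c f hf
    rw [mem_ofPred_eq] at *
    exact ContDiff.smul contDiff_const hf

/-- The space `C^∞(𝕋 × ℝ)` of space-time test functions; the first argument is time. -/
structure TestFunction where
  toFun : ℝ → Torus → ℝ
  smooth : ContDiff ℝ ∞ (fun z : ℝ × ℝ => toFun z.1 (z.2 : Torus))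

/-- The time slice `φ(·, t)`, an element of `C^∞(𝕋)`. -/
def TestFunction.slice (φ : TestFunction) (t : ℝ) : smoothTorus :=
  ⟨φ.toFun t, φ.smooth.comp (contDiff_const.prodMk contDiff_id)⟩

/-- The time derivative `∂ₜ φ`. -/
def TestFunction.dt (φ : TestFunction) (t : ℝ) (x : Torus) : ℝ :=
  deriv (fun s => φ.toFun s x) t

/-- The Fourier multiplier `f ↦ ∑ₖ m(k) f̂ₖ e^{ikx}`, with `f̂ₖ = (2π)⁻¹ ∫ f(x) e^{-ikx} dx`.
It is used only for symbols with `m(-k)` conjugate to `m(k)`, which map real functions to real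
functions, so that taking the real part does not change the value. -/
def fourierMultiplier (m : ℤ → ℂ) (f : Torus → ℝ) (x : Torus) : ℝ :=
  (∑' k : ℤ, m k * fourierCoeff (fun y => (f y : ℂ)) k * fourier k x).re

/-- The dispersive operator `𝓛_α`, with symbol `i k |k|^{2α-1}`. -/
def dispersive (α : ℝ) : (Torus → ℝ) → Torus → ℝ :=
  fourierMultiplier fun k => Complex.I * (k : ℂ) * ((|(k : ℝ)| ^ (2 * α - 1) : ℝ) : ℂ)

/-- The even cutoffs from which a Littlewood-Paley decomposition is built. -/
structure IsCutoff (ψ : ℝ → ℝ) : Prop where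
  smooth : ContDiff ℝ ∞ ψ
  even : ∀ ξ, ψ (-ξ) = ψ ξ
  eq_one : ∀ ξ ∈ Metric.ball (0 : ℝ) (3 / 4), ψ ξ = 1
  tsupport_subset : tsupport ψ ⊆ Metric.ball 0 1

/-- The dyadic symbol `ψ_q`, for integers `q ≥ -1`. -/
def dyadicSymbol (ψ : ℝ → ℝ) (q : ℤ) (ξ : ℝ) : ℝ :=
  if q = -1 then ψ ξ else ψ (ξ * (2 : ℝ) ^ (-(q + 1))) - ψ (ξ * (2 : ℝ) ^ (-q))

/-- The Littlewood-Paley projection `Δ_q`, for integers `q ≥ -1`. -/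
def lpProj (ψ : ℝ → ℝ) (q : ℤ) : (Torus → ℝ) → Torus → ℝ :=
  fourierMultiplier fun k => ((dyadicSymbol ψ q (k : ℝ) : ℝ) : ℂ)

/-- The Besov norm `|f|_{B^s_{r,1}} = ∑_{q ≥ -1} 2^{qs} |Δ_q f|_{L^r}` (summed over `q = n - 1`,
`n : ℕ`). -/
def besovNorm (ψ : ℝ → ℝ) (s : ℝ) (r : ℝ≥0∞) (f : Torus → ℝ) : ℝ≥0∞ :=
  ∑' n : ℕ, ENNReal.ofReal ((2 : ℝ) ^ (((n : ℝ) - 1) * s)) *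
    eLpNorm (lpProj ψ ((n : ℤ) - 1) f) r volume

/-- The supremum over all times `t ∈ [0, S]` of `|f(·, t)|_{L^p}`, possibly infinite. -/
def supLpNorm (p : ℝ≥0∞) (S : ℝ) (f : ℝ → L1) : ℝ≥0∞ :=
  ⨆ t ∈ Icc (0 : ℝ) S, eLpNorm (f t) p volume

/-- The data of a model equation `∂ₜ f = 𝓛_α f̄ + F_t`: a map `f ↦ f̄` on time-dependent functions
(possibly nonlinear, and nonlocal in space and time), and a time-dependent distribution `F_t`. -/
structure ModelEquation where
  bar : (ℝ → L1) → ℝ → L1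
  forcing : ℝ → smoothTorus →ₗ[ℝ] ℝ

/-- First assumption: `|f(·, t) - f̄(·, t)|_{L^p} ≲ t^δ` for all small `t ≥ 0`, for every `f` in
`L^∞(0,T; L¹)` that is bounded in `L^p` on some initial time interval. The constant and the time
interval may depend on `f`. For small `t` this bounds `f̄` in `L^p`. -/
def ModelEquation.BarAssumption (E : ModelEquation) (p : ℝ≥0∞) (δ T : ℝ) : Prop :=
  ∀ f : ℝ → L1, MemLp f ⊤ (volume.restrict (Icc 0 T)) →
    (∃ S, 0 < S ∧ supLpNorm p S f < ⊤) →
    ∃ C t₀ : ℝ, 0 < t₀ ∧ ∀ t ∈ Icc 0 t₀,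
      eLpNorm (fun x => f t x - E.bar f t x) p volume ≤ ENNReal.ofReal (C * t ^ δ)

/-- Second assumption: `|F_t(φ)| ≲ |φ|_{B^{2α-δ}_{p',1}}` for all `φ ∈ C^∞(𝕋)`, uniformly in time,
where `p'` is the Hölder conjugate of `p`. -/
def ModelEquation.ForcingAssumption (E : ModelEquation) (ψ : ℝ → ℝ) (α : ℝ) (p : ℝ≥0∞)
    (δ T : ℝ) : Prop :=
  ∃ C : ℝ≥0, ∀ t ∈ Icc 0 T, ∀ φ : smoothTorus,
    ‖E.forcing t φ‖ₑ ≤ C * besovNorm ψ (2 * α - δ) (ENNReal.conjExponent p) φ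

/-- `f` is a weak solution on `[0, T]` of `∂ₜ f = 𝓛_α f̄ + F_t` with initial data `f₀`. The
fields `bar_integrable` and `forcing_integrable` say that the integrals in the weak formulation
make sense. -/
structure ModelEquation.IsWeakSolution (E : ModelEquation) (α T : ℝ) (f₀ : Torus → ℝ)
    (f : ℝ → L1) : Prop where
  /-- `f ∈ L^∞(0,T; L¹(𝕋))`. -/
  memLp_top : MemLp f ⊤ (volume.restrict (Icc 0 T))
  /-- `t ↦ f(·, t)` is continuous as a distribution. -/
  continuous : ∀ φ : smoothTorus,
    ContinuousOn (fun t => ∫ x, f t x * (φ : Torus → ℝ) x) (Icc 0 T)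
  /-- `f̄ ∈ L¹(0,T; L¹(𝕋))`. -/
  bar_integrable : IntegrableOn (E.bar f) (Icc 0 T) volume
  forcing_integrable : ∀ φ : TestFunction,
    IntervalIntegrable (fun t => E.forcing t (φ.slice t)) volume 0 T
  weak_formulation : ∀ φ : TestFunction,
    (∫ x, f T x * φ.toFun T x) - (∫ x, f₀ x * φ.toFun 0 x) =
      (∫ t in (0 : ℝ)..T, ∫ x, (f t x * φ.dt t x - E.bar f t x * dispersive α (φ.toFun t) x)) +
        ∫ t in (0 : ℝ)..T, E.forcing t (φ.slice t)

end DispersiveModel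

end

noncomputable section
namespace DispersiveModel

/-! Write β = 2α and e = 1/p. The equation is tested against a real wave packet w of frequency about
N that solves the free equation ∂ₛw = 𝓛_α w. Its phases are aligned at a small time t, and it is
switched off smoothly on [t - N^{-β}, t]. Put K = tN^β ≥ 1. Since w solves the free equation, only
three terms remain besides the pairing of f₀ with w(0): f against w near time t, f - f̄ against 𝓛_α
w, and the forcing. Near time t the packet has size N on a set of measure 1/N, so its L^{p'} norm is
at most a constant times N^e. If f is bounded in L^p up to time t, then |∫ f₀ w(0)| ≲ N^e (1 + K²
t^δ + K² N^{-δ}); this is `exists_abs_integral_mul_wave_le`.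

At time 0 the same packet is dispersed. With K = J^8, a second-derivative test for exponential sums
(`exists_norm_expSum_le`) bounds it uniformly by a multiple of N/J, while its L² norm squared is
still comparable to N. Interpolation bounds its L^p norm by a multiple of N^{1-e} J^{-(1-2e)}.
Pairing the packet with itself therefore shows that the functional g ↦ N^{-e} ∫ g w(0) on L^p has
norm at least a multiple of J^{1-2e}, which is unbounded because p > 2. Taking N large in terms of J
makes both error terms at most 1 (`exists_scale`). The uniform boundedness principle then gives one
datum, chosen before the equation, whose normalised pairings are unbounded
(`exists_unbounded_wavePairing`), so no solution can stay bounded in L^p.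

For an even datum g(x) + g(-x), the packet is replaced by twice its even part. Its coefficients
carry cos(t k^β), and the L² lower bound follows from cos² = (1 + cos 2·)/2 and the same exponential
sum estimate at time 2t. -/

/-! ### Trigonometric polynomials: Parseval, differencing and multipliers. -/

/-- The one-sided trigonometric polynomial `∑_{k < M} c_k e^{ikx}`. -/
def trigPoly (M : ℕ) (c : ℕ → ℂ) (x : Torus) : ℂ :=
  ∑ k ∈ Finset.range M, c k * fourier (k : ℤ) x

lemma continuous_trigPoly (M : ℕ) (c : ℕ → ℂ) : Continuous (trigPoly M c) := by
  unfold trigPoly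
  fun_prop

lemma fourierCoeff_fourier_apply (m n : ℤ) :
    fourierCoeff (fun x : Torus => fourier m x) n = if n = m then 1 else 0 := by
  rw [show (fun x : Torus => fourier m x) = ⇑(fourier m : C(Torus, ℂ)) from rfl,
    fourierCoeff_fourier, Pi.single_apply]

lemma integral_fourier_mul_conj (m n : ℤ) :
    ∫ x : Torus, fourier m x * (starRingEnd ℂ) (fourier n x) =
      if n = m then (2 * Real.pi : ℂ) else 0 := by
  have h := fourierCoeff_fourier_apply m n
  rw [fourierCoeff, AddCircle.integral_haarAddCircle] at h
  have h2 : ∫ x : Torus, fourier m x * (starRingEnd ℂ) (fourier n x) =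
      ∫ x : Torus, fourier (-n) x • fourier m x := by
    congr 1; ext x; rw [fourier_neg, smul_eq_mul, mul_comm]
  rw [h2]
  have hpi : (2 * Real.pi) ≠ 0 := Real.two_pi_pos.ne'
  have h3 : ((2 * Real.pi : ℝ)) • ((2 * Real.pi)⁻¹ • ∫ x : Torus, fourier (-n) x • fourier m x) =
      (2 * Real.pi : ℝ) • (if n = m then (1 : ℂ) else 0) := by rw [h]
  rw [smul_smul, mul_inv_cancel₀ hpi, one_smul] at h3
  rw [h3]
  split_ifs <;> simp

lemma integral_norm_sq_trigPoly (M : ℕ) (c : ℕ → ℂ) :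
    ∫ x, ‖trigPoly M c x‖ ^ 2 = 2 * Real.pi * ∑ k ∈ Finset.range M, ‖c k‖ ^ 2 := by
  have h : ((∫ x, ‖trigPoly M c x‖ ^ 2 : ℝ) : ℂ) =
      ((2 * Real.pi * ∑ k ∈ Finset.range M, ‖c k‖ ^ 2 : ℝ) : ℂ) := by
    rw [← integral_complex_ofReal]
    have h1 : ∀ x, ((‖trigPoly M c x‖ ^ 2 : ℝ) : ℂ) =
        ∑ j ∈ Finset.range M, ∑ k ∈ Finset.range M, (c j * (starRingEnd ℂ) (c k)) *
          (fourier (j : ℤ) x * (starRingEnd ℂ) (fourier (k : ℤ) x)) := by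
      intro x
      rw [Complex.ofReal_pow, ← Complex.mul_conj', trigPoly, map_sum, Finset.sum_mul_sum]
      refine Finset.sum_congr rfl fun j _ => Finset.sum_congr rfl fun k _ => ?_
      rw [map_mul]; ring
    have hint : ∀ j k : ℕ, Integrable (fun x : Torus => (c j * (starRingEnd ℂ) (c k)) *
          (fourier (j : ℤ) x * (starRingEnd ℂ) (fourier (k : ℤ) x))) := by
      intro j k
      refine Continuous.integrable_of_hasCompactSupport ?_ (HasCompactSupport.of_compactSpace _)
      have : Continuous (fun x : Torus => (starRingEnd ℂ) (fourier (k : ℤ) x)) :=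
        Complex.continuous_conj.comp (fourier (k : ℤ)).continuous
      fun_prop
    simp_rw [h1]
    rw [integral_finsetSum _ fun j _ => integrable_finsetSum _ fun k _ => hint j k]
    simp_rw [integral_finsetSum _ fun k _ => hint _ k, integral_const_mul,
      integral_fourier_mul_conj]
    push_cast
    rw [Finset.mul_sum]
    refine Finset.sum_congr rfl fun j hj => ?_
    rw [Finset.sum_eq_single j]
    · simp only [if_true]
      rw [Complex.mul_conj']; ring
    · intro k _ hk
      have : (k : ℤ) ≠ j := by exact_mod_cast hk
      simp [this]
    · intro h; exact absurd hj h
  exact_mod_cast h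

/-- Summation by parts: multiplying by 1 - e^{ix} differences the coefficients, and the vanishing of
`c 0` and `c M` removes the boundary terms. This turns smoothness in k into decay away from x = 0.
-/
lemma norm_one_sub_fourier_mul_trigPoly (M : ℕ) (c : ℕ → ℂ) (h0 : c 0 = 0) (hM : c M = 0)
    (x : Torus) :
    ‖1 - fourier (1 : ℤ) x‖ * ‖trigPoly M c x‖ = ‖trigPoly M (fun k => c (k + 1) - c k) x‖ := by
  have h1 : trigPoly M c x = ∑ k ∈ Finset.range M, c (k + 1) * fourier ((k : ℤ) + 1) x := by
    have h2 := Finset.sum_range_succ (fun k : ℕ => c k * fourier (k : ℤ) x) M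
    have h3 := Finset.sum_range_succ' (fun k : ℕ => c k * fourier (k : ℤ) x) M
    rw [trigPoly]
    simp only [hM, h0, zero_mul, add_zero] at h2 h3
    rw [← h2, h3]
    push_cast
    rfl
  have h4 : (1 - fourier (1 : ℤ) x) * trigPoly M c x =
      fourier (1 : ℤ) x * trigPoly M (fun k => c (k + 1) - c k) x := by
    rw [sub_mul, one_mul]
    nth_rewrite 1 [h1]
    rw [trigPoly, trigPoly, Finset.mul_sum, Finset.mul_sum, ← Finset.sum_sub_distrib]
    refine Finset.sum_congr rfl fun k _ => ?_
    rw [fourier_add]; ring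
  have h5 : ‖(fourier (1 : ℤ) x : ℂ)‖ = 1 := by
    rw [fourier_apply]; exact Circle.norm_coe _
  rw [← norm_mul, h4, norm_mul, h5, one_mul]

lemma fourierCoeff_re_trigPoly (M : ℕ) (c : ℕ → ℂ) (n : ℤ) :
    fourierCoeff (fun y => (((trigPoly M c y).re : ℝ) : ℂ)) n =
      ∑ k ∈ Finset.range M, ((if n = (k : ℤ) then c k / 2 else 0) +
        (if n = -(k : ℤ) then (starRingEnd ℂ) (c k) / 2 else 0)) := by
  have h1 : (fun y => (((trigPoly M c y).re : ℝ) : ℂ)) =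
      ∑ k ∈ Finset.range M, fun y : Torus => ((c k / 2) * fourier (k : ℤ) y +
        ((starRingEnd ℂ) (c k) / 2) * fourier (-(k : ℤ)) y) := by
    ext y
    rw [Complex.re_eq_add_conj, trigPoly, map_sum, Finset.sum_apply, ← Finset.sum_add_distrib,
      Finset.sum_div]
    refine Finset.sum_congr rfl fun k _ => ?_
    rw [map_mul, fourier_neg]; ring
  have hi : ∀ (d : ℂ) (m : ℤ), Integrable (fun y : Torus => d * fourier m y)
      AddCircle.haarAddCircle := by
    intro d m
    refine Continuous.integrable_of_hasCompactSupport ?_ (HasCompactSupport.of_compactSpace _)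
    fun_prop
  rw [h1, fourierCoeff.sum]
  · simp only [Finset.sum_apply]
    refine Finset.sum_congr rfl fun k _ => ?_
    have := fourierCoeff.add (hi (c k / 2) k) (hi ((starRingEnd ℂ) (c k) / 2) (-k))
    have h2 := congrFun this n
    rw [show (fun y : Torus => ((c k / 2) * fourier (k : ℤ) y +
        ((starRingEnd ℂ) (c k) / 2) * fourier (-(k : ℤ)) y)) =
        (fun y : Torus => (c k / 2) * fourier (k : ℤ) y) +
        (fun y : Torus => ((starRingEnd ℂ) (c k) / 2) * fourier (-(k : ℤ)) y) from rfl]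
    rw [h2, Pi.add_apply, fourierCoeff.const_mul, fourierCoeff.const_mul,
      fourierCoeff_fourier_apply, fourierCoeff_fourier_apply]
    simp
  · intro k _
    exact (hi _ _).add (hi _ _)

/-- A Fourier multiplier with conjugation-symmetric symbol acts on the real part of a one-sided
trigonometric polynomial by multiplication of the coefficients. -/
lemma fourierMultiplier_re_trigPoly (m : ℤ → ℂ) (hm : ∀ k, m (-k) = (starRingEnd ℂ) (m k))
    (M : ℕ) (c : ℕ → ℂ) (x : Torus) :
    fourierMultiplier m (fun y => (trigPoly M c y).re) x =
      (trigPoly M (fun k => m k * c k) x).re := by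
  unfold fourierMultiplier
  simp_rw [fourierCoeff_re_trigPoly]
  have h1 : ∀ n : ℤ, m n * (∑ k ∈ Finset.range M, ((if n = (k : ℤ) then c k / 2 else 0) +
        (if n = -(k : ℤ) then (starRingEnd ℂ) (c k) / 2 else 0))) * fourier n x =
      ∑ k ∈ Finset.range M, ((if n = (k : ℤ) then m k * (c k / 2) * fourier (k : ℤ) x else 0) +
        (if n = -(k : ℤ) then m (-k) * ((starRingEnd ℂ) (c k) / 2) * fourier (-(k : ℤ)) x
          else 0)) := by
    intro n
    rw [Finset.mul_sum, Finset.sum_mul]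
    refine Finset.sum_congr rfl fun k _ => ?_
    rw [mul_add, add_mul]
    congr 1
    · split_ifs with h
      · rw [h]
      · simp
    · split_ifs with h
      · rw [h]
      · simp
  simp_rw [h1]
  have hs : ∀ (a : ℤ) (z : ℂ), HasSum (fun n : ℤ => if n = a then z else 0) z := fun a z =>
    hasSum_ite_eq a z
  have h2 := hasSum_sum (s := Finset.range M) fun (k : ℕ) _ =>
    (hs (k : ℤ) (m k * (c k / 2) * fourier (k : ℤ) x)).add
      (hs (-(k : ℤ)) (m (-k) * ((starRingEnd ℂ) (c k) / 2) * fourier (-(k : ℤ)) x))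
  rw [h2.tsum_eq, trigPoly, Complex.re_sum, Complex.re_sum]
  refine Finset.sum_congr rfl fun k _ => ?_
  rw [hm, fourier_neg, Complex.add_re]
  have : (starRingEnd ℂ) (m k) * ((starRingEnd ℂ) (c k) / 2) * (starRingEnd ℂ) (fourier (k : ℤ) x)
      = (starRingEnd ℂ) (m k * (c k / 2) * fourier (k : ℤ) x) := by
    rw [map_mul, map_mul, map_div₀, map_ofNat]
  rw [this, Complex.conj_re, ← two_mul, ← Complex.re_ofReal_mul]
  congr 1
  push_cast; ring

/-! ### Bump coefficients and the L^{p'} norm of concentrated packets. -/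

/-- Coefficients supported in `(N, 3N)`, of size at most `A`, and with increments at most
`A / N`. -/
structure IsBump (N : ℕ) (A : ℝ) (c : ℕ → ℂ) : Prop where
  norm_le : ∀ k, ‖c k‖ ≤ A
  norm_sub_le : ∀ k, ‖c (k + 1) - c k‖ ≤ A / N
  eq_zero_of_le : ∀ k, k ≤ N → c k = 0
  eq_zero_of_ge : ∀ k, 3 * N ≤ k → c k = 0

lemma IsBump.nonneg {N : ℕ} {A : ℝ} {c : ℕ → ℂ} (h : IsBump N A c) : 0 ≤ A :=
  (norm_nonneg _).trans (h.norm_le 0)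

lemma IsBump.mono {N : ℕ} {A B : ℝ} {c : ℕ → ℂ} (h : IsBump N A c) (hAB : A ≤ B) :
    IsBump N B c where
  norm_le k := (h.norm_le k).trans hAB
  norm_sub_le k := (h.norm_sub_le k).trans (by gcongr)
  eq_zero_of_le := h.eq_zero_of_le
  eq_zero_of_ge := h.eq_zero_of_ge

/-- Discrete Leibniz rule. The multiplier needs control on [N, 3N] only, because `c` vanishes
elsewhere; all later symbols (phases, frequencies, Littlewood-Paley cutoffs, regularised inverses)
enter through this lemma. -/
lemma IsBump.mul {N : ℕ} {A B : ℝ} {c m : ℕ → ℂ} (h : IsBump N A c)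
    (hm : ∀ k, N ≤ k → k ≤ 3 * N → ‖m k‖ ≤ B)
    (hm' : ∀ k, N ≤ k → k < 3 * N → ‖m (k + 1) - m k‖ ≤ B / N) :
    IsBump N (2 * A * B) (fun k => m k * c k) := by
  have hA := h.nonneg
  have hB : 0 ≤ B := (norm_nonneg _).trans (hm N le_rfl (by omega))
  have hAB : 0 ≤ A * B := mul_nonneg hA hB
  refine ⟨fun k => ?_, fun k => ?_, fun k hk => ?_, fun k hk => ?_⟩
  · by_cases hk : N ≤ k ∧ k ≤ 3 * N
    · rw [norm_mul]
      calc ‖m k‖ * ‖c k‖ ≤ B * A :=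
            mul_le_mul (hm k hk.1 hk.2) (h.norm_le k) (norm_nonneg _) hB
        _ ≤ _ := by linarith
    · have : c k = 0 := by
        by_cases h1 : k ≤ N
        · exact h.eq_zero_of_le k h1
        · exact h.eq_zero_of_ge k (by omega)
      rw [this, mul_zero, norm_zero]; linarith
  · have e : m (k + 1) * c (k + 1) - m k * c k =
        m (k + 1) * (c (k + 1) - c k) + (m (k + 1) - m k) * c k := by ring
    by_cases hk : N ≤ k ∧ k < 3 * N
    · rw [e]
      calc _ ≤ ‖m (k + 1)‖ * ‖c (k + 1) - c k‖ + ‖m (k + 1) - m k‖ * ‖c k‖ := by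
            rw [← norm_mul, ← norm_mul]; exact norm_add_le _ _
        _ ≤ B * (A / N) + B / N * A := by
            gcongr
            · exact hm _ (by omega) (by omega)
            · exact h.norm_sub_le k
            · exact hm' k hk.1 hk.2
            · exact h.norm_le k
        _ = 2 * A * B / N := by ring
    · have : c k = 0 ∧ c (k + 1) = 0 := by
        by_cases h1 : k < N
        · exact ⟨h.eq_zero_of_le k h1.le, h.eq_zero_of_le _ h1⟩
        · exact ⟨h.eq_zero_of_ge k (by omega), h.eq_zero_of_ge _ (by omega)⟩
      simp only [this.1, this.2, mul_zero, sub_zero, norm_zero]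
      positivity
  · simp [h.eq_zero_of_le k hk]
  · simp [h.eq_zero_of_ge k hk]

lemma eLpNorm_two_sq (g : Torus → ℝ) (hg : Continuous g) :
    eLpNorm g 2 volume = ENNReal.ofReal (Real.sqrt (∫ x, g x ^ 2)) := by
  rw [eLpNorm_eq_lintegral_rpow_enorm_toReal two_ne_zero ENNReal.ofNat_ne_top]
  have h0 : 0 ≤ ∫ x, g x ^ 2 := integral_nonneg fun x => sq_nonneg _
  rw [Real.sqrt_eq_rpow, ← ENNReal.ofReal_rpow_of_nonneg h0 (by norm_num),
    ofReal_integral_eq_lintegral_ofReal]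
  · simp only [ENNReal.toReal_ofNat, ENNReal.rpow_ofNat]
    congr 2
    ext x
    rw [← ofReal_norm, ← ENNReal.ofReal_pow (norm_nonneg _), Real.norm_eq_abs, sq_abs]
  · exact Continuous.integrable_of_hasCompactSupport (by fun_prop)
      (HasCompactSupport.of_compactSpace _)
  · exact Filter.Eventually.of_forall fun x => sq_nonneg _

/-- The weight `1 + N² |1 - e^{ix}|²`, which measures concentration at scale `1 / N`. -/
def weight (N : ℕ) (x : Torus) : ℝ := 1 + (N : ℝ) ^ 2 * ‖1 - (fourier (1 : ℤ) x : ℂ)‖ ^ 2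

lemma continuous_weight (N : ℕ) : Continuous (weight N) := by
  unfold weight; fun_prop

lemma one_le_weight (N : ℕ) (x : Torus) : 1 ≤ weight N x := by
  unfold weight; nlinarith [mul_nonneg (sq_nonneg (N : ℝ)) (sq_nonneg ‖1 - (fourier (1 : ℤ) x : ℂ)‖)]

/-- |1 - e^{ix}| = 2|sin(x/2)|, and Jordan's inequality with π ≤ 4 bounds this below by |x|/2. -/
lemma le_weight_coe (N : ℕ) {x : ℝ} (hx : |x| ≤ Real.pi) :
    1 + ((N : ℝ) / 2 * x) ^ 2 ≤ weight N (x : Torus) := by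
  have h1 : ‖1 - (fourier (1 : ℤ) (x : Torus) : ℂ)‖ = 2 * |Real.sin (x / 2)| := by
    have : (fourier (1 : ℤ) (x : Torus) : ℂ) = Complex.exp (Complex.I * x) := by
      rw [fourier_coe_apply]
      congr 1
      push_cast
      have : (Real.pi : ℂ) ≠ 0 := by exact_mod_cast Real.pi_ne_zero
      field_simp
    rw [this, norm_sub_rev, Complex.norm_exp_I_mul_ofReal_sub_one, norm_mul, Real.norm_eq_abs,
      Real.norm_eq_abs, abs_two]
  have h2 := Real.mul_abs_le_abs_sin (x := x / 2) (by rw [abs_div, abs_two]; linarith)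
  have h3 : |x| / 2 ≤ ‖1 - (fourier (1 : ℤ) (x : Torus) : ℂ)‖ := by
    rw [h1]
    have h4 : (1 / 2 : ℝ) ≤ 2 / Real.pi := by
      rw [div_le_div_iff₀ two_pos Real.pi_pos]; linarith [Real.pi_le_four]
    have h5 : 1 / 2 * |x / 2| ≤ 2 / Real.pi * |x / 2| := by gcongr
    rw [abs_div, abs_two] at h5 h2
    linarith [abs_nonneg x]
  unfold weight
  have h6 : (|x| / 2) ^ 2 ≤ ‖1 - (fourier (1 : ℤ) (x : Torus) : ℂ)‖ ^ 2 := by gcongr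
  have h7 : ((N : ℝ) / 2 * x) ^ 2 = (N : ℝ) ^ 2 * (|x| / 2) ^ 2 := by
    rw [div_pow, sq_abs]; ring
  rw [h7]; gcongr

lemma integral_inv_weight_le {N : ℕ} (hN : 0 < N) : ∫ x, (weight N x)⁻¹ ≤ 8 / N := by
  have hN' : (0 : ℝ) < N := by exact_mod_cast hN
  rw [← AddCircle.integral_preimage (2 * Real.pi) (-Real.pi)]
  have e : -Real.pi + 2 * Real.pi = Real.pi := by ring
  rw [e]
  have hI : Integrable fun x : ℝ => (1 + ((N : ℝ) / 2 * x) ^ 2)⁻¹ :=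
    integrable_inv_one_add_sq.comp_mul_left' (by positivity)
  calc ∫ x in Ioc (-Real.pi) Real.pi, (weight N (x : Torus))⁻¹
      ≤ ∫ x in Ioc (-Real.pi) Real.pi, (1 + ((N : ℝ) / 2 * x) ^ 2)⁻¹ := by
        refine setIntegral_mono_on ?_ hI.integrableOn measurableSet_Ioc fun x hx => ?_
        · refine (Continuous.integrableOn_Icc ?_).mono_set Ioc_subset_Icc_self
          refine Continuous.inv₀ ((continuous_weight N).comp (AddCircle.continuous_mk' _)) ?_
          intro x
          exact (zero_lt_one.trans_le (one_le_weight N _)).ne'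
        · gcongr
          exact le_weight_coe N (abs_le.2 ⟨hx.1.le, hx.2⟩)
    _ ≤ ∫ x : ℝ, (1 + ((N : ℝ) / 2 * x) ^ 2)⁻¹ :=
        setIntegral_le_integral hI (Filter.Eventually.of_forall fun x => by positivity)
    _ = |((N : ℝ) / 2)⁻¹| * Real.pi := by
        rw [Measure.integral_comp_mul_left (fun x : ℝ => (1 + x ^ 2)⁻¹),
          integral_univ_inv_one_add_sq, smul_eq_mul]
    _ ≤ 8 / N := by
        rw [abs_of_pos (by positivity), inv_div]
        calc 2 / (N : ℝ) * Real.pi ≤ 2 / (N : ℝ) * 4 := by gcongr; exact Real.pi_le_four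
          _ = 8 / N := by ring

/-- Parseval applied to the polynomial and to its differenced coefficients: the factor N² in the
weight is cancelled by increments of size A/N, so both parts contribute 6πA²N. -/
lemma integral_weight_mul_norm_sq_trigPoly_le {N : ℕ} (hN : 0 < N) {A : ℝ} {c : ℕ → ℂ}
    (hc : IsBump N A c) :
    ∫ x, weight N x * ‖trigPoly (3 * N) c x‖ ^ 2 ≤ 48 * A ^ 2 * N := by
  have hN' : (0 : ℝ) < N := by exact_mod_cast hN
  have h1 : ∀ x, weight N x * ‖trigPoly (3 * N) c x‖ ^ 2 = ‖trigPoly (3 * N) c x‖ ^ 2 +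
      (N : ℝ) ^ 2 * ‖trigPoly (3 * N) (fun k => c (k + 1) - c k) x‖ ^ 2 := by
    intro x
    rw [← norm_one_sub_fourier_mul_trigPoly (3 * N) c (hc.eq_zero_of_le 0 (by omega))
      (hc.eq_zero_of_ge _ le_rfl), weight]
    ring
  have hint : ∀ d, Integrable fun x => ‖trigPoly (3 * N) d x‖ ^ 2 := fun d =>
    Continuous.integrable_of_hasCompactSupport
      ((continuous_trigPoly (3 * N) d).norm.pow 2) (HasCompactSupport.of_compactSpace _)
  simp_rw [h1]
  rw [integral_add (hint _) ((hint _).const_mul _), integral_const_mul, integral_norm_sq_trigPoly,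
    integral_norm_sq_trigPoly]
  have h2 : ∑ k ∈ Finset.range (3 * N), ‖c k‖ ^ 2 ≤ 3 * N * A ^ 2 := by
    calc _ ≤ ∑ k ∈ Finset.range (3 * N), A ^ 2 := by
          gcongr with k; exact hc.norm_le k
      _ = _ := by simp
  have h3 : ∑ k ∈ Finset.range (3 * N), ‖c (k + 1) - c k‖ ^ 2 ≤ 3 * N * (A / N) ^ 2 := by
    calc _ ≤ ∑ k ∈ Finset.range (3 * N), (A / N) ^ 2 := by
          gcongr with k; exact hc.norm_sub_le k
      _ = _ := by simp
  have hpi := Real.pi_pos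
  calc _ ≤ 2 * Real.pi * (3 * N * A ^ 2) + (N : ℝ) ^ 2 * (2 * Real.pi * (3 * N * (A / N) ^ 2)) := by
        gcongr
    _ = 12 * A ^ 2 * N * Real.pi := by field_simp; ring
    _ ≤ 12 * A ^ 2 * N * 4 := by gcongr; exact Real.pi_le_four
    _ = _ := by ring

lemma toReal_inv_lt_half {p : ℝ≥0∞} (hp : 2 < p) : (p⁻¹).toReal < 1 / 2 := by
  have h : p⁻¹ < 2⁻¹ := ENNReal.inv_lt_inv.2 hp
  have := ENNReal.toReal_strict_mono (by simp) h
  simpa using this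

/-- As the weight is at least 1 and r ≥ 2, its power -r/2 is at most its inverse, whose integral is
O(1/N). -/
lemma eLpNorm_inv_sqrt_weight_le {N : ℕ} (hN : 0 < N) {r : ℝ≥0∞} (hr : 2 ≤ r) (hr' : r ≠ ⊤) :
    eLpNorm (fun x => (Real.sqrt (weight N x))⁻¹) r volume ≤
      ENNReal.ofReal ((8 / N) ^ (1 / r.toReal)) := by
  have hN' : (0 : ℝ) < N := by exact_mod_cast hN
  have hr0 : r ≠ 0 := (zero_lt_two.trans_le hr).ne'
  have hr2 : 2 ≤ r.toReal := by simpa using ENNReal.toReal_mono hr' hr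
  rw [eLpNorm_eq_lintegral_rpow_enorm_toReal hr0 hr',
    ← ENNReal.ofReal_rpow_of_nonneg (by positivity) (by positivity)]
  gcongr
  have hc : Continuous fun x => (weight N x)⁻¹ :=
    (continuous_weight N).inv₀ fun x => (zero_lt_one.trans_le (one_le_weight N _)).ne'
  calc ∫⁻ x, ‖(Real.sqrt (weight N x))⁻¹‖ₑ ^ r.toReal
      ≤ ∫⁻ x, ENNReal.ofReal ((weight N x)⁻¹) := by
        refine lintegral_mono fun x => ?_
        have h1 := one_le_weight N x
        have h0 : 0 ≤ (Real.sqrt (weight N x))⁻¹ := by positivity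
        rw [Real.enorm_of_nonneg h0, ENNReal.ofReal_rpow_of_nonneg h0 (by linarith)]
        refine ENNReal.ofReal_le_ofReal ?_
        have h2 : (Real.sqrt (weight N x))⁻¹ ≤ 1 := inv_le_one_of_one_le₀ (Real.one_le_sqrt.2 h1)
        calc _ ≤ (Real.sqrt (weight N x))⁻¹ ^ (2 : ℝ) :=
              Real.rpow_le_rpow_of_exponent_ge (by positivity) h2 hr2
          _ = _ := by rw [Real.rpow_two, inv_pow, Real.sq_sqrt (by linarith)]
    _ = ENNReal.ofReal (∫ x, (weight N x)⁻¹) := by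
        rw [ofReal_integral_eq_lintegral_ofReal]
        · exact Continuous.integrable_of_hasCompactSupport hc (HasCompactSupport.of_compactSpace _)
        · exact Filter.Eventually.of_forall fun x =>
            inv_nonneg.2 (zero_le_one.trans (one_le_weight N x))
    _ ≤ _ := ENNReal.ofReal_le_ofReal (integral_inv_weight_le hN)

/-- A trigonometric polynomial with bump coefficients at scale `N` has the `L^{p'}` norm of a
function of size `N` concentrated on a set of measure `1 / N`. -/
lemma eLpNorm_re_trigPoly_le {p : ℝ≥0∞} (hp : 2 < p) {N : ℕ} (hN : 0 < N) {A : ℝ} {c : ℕ → ℂ}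
    (hc : IsBump N A c) :
    eLpNorm (fun x => (trigPoly (3 * N) c x).re) (ENNReal.conjExponent p) volume ≤
      ENNReal.ofReal (56 * A * (N : ℝ) ^ (p⁻¹).toReal) := by
  have hN' : (0 : ℝ) < N := by exact_mod_cast hN
  have hA := hc.nonneg
  set e := (p⁻¹).toReal with he
  have he2 : e < 1 / 2 := toReal_inv_lt_half hp
  have he0 : 0 ≤ e := ENNReal.toReal_nonneg
  -- Hölder exponent with 1/r + 1/2 = 1/p'. Writing P = w^{-1/2} · w^{1/2}P, the first factor lies
  -- in L^r and the second is bounded in L² by the weighted Parseval estimate; p > 2 makes r finite.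
  set r : ℝ≥0∞ := (2⁻¹ - p⁻¹)⁻¹ with hr
  have hpi : p⁻¹ < 2⁻¹ := ENNReal.inv_lt_inv.2 hp
  have hp1 : 1 ≤ p := one_le_two.trans hp.le
  have hrtop : r ≠ ⊤ := ENNReal.inv_ne_top.2 (tsub_pos_of_lt hpi).ne'
  have hr2 : 2 ≤ r := by
    rw [hr, ENNReal.le_inv_iff_le_inv]; exact tsub_le_self
  have hrr : 1 / r.toReal = 1 / 2 - e := by
    rw [hr, ENNReal.toReal_inv, ENNReal.toReal_sub_of_le hpi.le (by simp)]
    simp [he]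
  have := ENNReal.HolderConjugate.conjExponent hp1
  have hq : (ENNReal.conjExponent p)⁻¹ = 1 - p⁻¹ := by
    have h1 := ENNReal.HolderConjugate.inv_add_inv_eq_one p (ENNReal.conjExponent p)
    rw [← h1, ENNReal.add_sub_cancel_left]
    exact (hpi.trans_le le_top).ne
  have hT : ENNReal.HolderTriple r 2 (ENNReal.conjExponent p) := by
    rw [ENNReal.holderTriple_iff, hq, hr, inv_inv]
    rw [← ENNReal.inv_two_add_inv_two]
    refine ENNReal.eq_sub_of_add_eq (hpi.trans_le le_top).ne ?_
    rw [add_right_comm, tsub_add_cancel_of_le hpi.le]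
  have hw : Continuous fun x => Real.sqrt (weight N x) := (continuous_weight N).sqrt
  have hwi : Continuous fun x => (Real.sqrt (weight N x))⁻¹ :=
    hw.inv₀ fun x => (Real.sqrt_pos.2 (zero_lt_one.trans_le (one_le_weight N _))).ne'
  have hct : Continuous fun x => (trigPoly (3 * N) c x).re :=
    Complex.continuous_re.comp (continuous_trigPoly _ _)
  have h1 := eLpNorm_smul_le_mul_eLpNorm (p := r) (q := 2) (r := ENNReal.conjExponent p)
    (μ := (volume : Measure Torus))
    (f := fun x => Real.sqrt (weight N x) * (trigPoly (3 * N) c x).re)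
    (hw.mul hct).aestronglyMeasurable
    (φ := fun x => (Real.sqrt (weight N x))⁻¹) hwi.aestronglyMeasurable
  have h2 : ((fun x => (Real.sqrt (weight N x))⁻¹) •
      fun x => Real.sqrt (weight N x) * (trigPoly (3 * N) c x).re) =
      fun x => (trigPoly (3 * N) c x).re := by
    ext x
    rw [Pi.smul_apply', smul_eq_mul, inv_mul_cancel_left₀]
    exact (Real.sqrt_pos.2 (zero_lt_one.trans_le (one_le_weight N _))).ne'
  rw [h2] at h1
  refine h1.trans ?_
  have h3 : eLpNorm (fun x => Real.sqrt (weight N x) * (trigPoly (3 * N) c x).re) 2 volume ≤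
      ENNReal.ofReal (7 * A * (N : ℝ) ^ (1 / 2 : ℝ)) := by
    rw [eLpNorm_two_sq (fun x => Real.sqrt (weight N x) * (trigPoly (3 * N) c x).re) (hw.mul hct)]
    refine ENNReal.ofReal_le_ofReal (Real.sqrt_le_iff.2 ⟨by positivity, ?_⟩)
    calc ∫ x, (Real.sqrt (weight N x) * (trigPoly (3 * N) c x).re) ^ 2
        ≤ ∫ x, weight N x * ‖trigPoly (3 * N) c x‖ ^ 2 := by
          refine integral_mono ?_ ?_ fun x => ?_
          · exact Continuous.integrable_of_hasCompactSupport ((hw.mul hct).pow 2)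
              (HasCompactSupport.of_compactSpace _)
          · exact Continuous.integrable_of_hasCompactSupport
              ((continuous_weight N).mul ((continuous_trigPoly _ _).norm.pow 2))
              (HasCompactSupport.of_compactSpace _)
          · have hw0 := zero_le_one.trans (one_le_weight N x)
            simp only [mul_pow, Real.sq_sqrt hw0]
            refine mul_le_mul_of_nonneg_left ?_ hw0
            rw [← sq_abs]
            have := Complex.abs_re_le_norm (trigPoly (3 * N) c x)
            gcongr
      _ ≤ 48 * A ^ 2 * N := integral_weight_mul_norm_sq_trigPoly_le hN hc
      _ ≤ (7 * A * (N : ℝ) ^ (1 / 2 : ℝ)) ^ 2 := by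
          rw [mul_pow, ← Real.sqrt_eq_rpow, Real.sq_sqrt hN'.le]
          nlinarith [mul_nonneg (sq_nonneg A) hN'.le]
  calc _ ≤ ENNReal.ofReal ((8 / N) ^ (1 / r.toReal)) *
        ENNReal.ofReal (7 * A * (N : ℝ) ^ (1 / 2 : ℝ)) :=
        mul_le_mul' (eLpNorm_inv_sqrt_weight_le hN hr2 hrtop) h3
    _ = ENNReal.ofReal ((8 / N) ^ (1 / r.toReal) * (7 * A * (N : ℝ) ^ (1 / 2 : ℝ))) :=
        (ENNReal.ofReal_mul (by positivity)).symm
    _ ≤ _ := by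
        refine ENNReal.ofReal_le_ofReal ?_
        rw [hrr, Real.div_rpow (by norm_num) hN'.le]
        have h8 : (8 : ℝ) ^ (1 / 2 - e) ≤ 8 := by
          calc (8 : ℝ) ^ (1 / 2 - e) ≤ 8 ^ (1 : ℝ) :=
                Real.rpow_le_rpow_of_exponent_le (by norm_num) (by linarith)
            _ = 8 := Real.rpow_one _
        have h9 : (N : ℝ) ^ (1 / 2 : ℝ) = (N : ℝ) ^ (1 / 2 - e) * (N : ℝ) ^ e := by
          rw [← Real.rpow_add hN']; congr 1; ring
        rw [h9]
        have h10 : (0 : ℝ) < (N : ℝ) ^ (1 / 2 - e) := by positivity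
        have h11 : (8 : ℝ) ^ (1 / 2 - e) / (N : ℝ) ^ (1 / 2 - e) *
            (7 * A * ((N : ℝ) ^ (1 / 2 - e) * (N : ℝ) ^ e)) =
            (8 : ℝ) ^ (1 / 2 - e) * (7 * A * (N : ℝ) ^ e) := by
          field_simp
        rw [h11]
        calc _ ≤ 8 * (7 * A * (N : ℝ) ^ e) := by gcongr
          _ = _ := by ring

/-! ### First and second differences of k^β. -/

lemma exists_rpow_sub_eq (β : ℝ) {a b : ℝ} (ha : 0 < a) (hab : a < b) :
    ∃ ξ ∈ Ioo a b, b ^ β - a ^ β = β * ξ ^ (β - 1) * (b - a) := by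
  obtain ⟨ξ, hξ, h⟩ := exists_hasDerivAt_eq_slope (fun y : ℝ => y ^ β)
    (fun y => β * y ^ (β - 1)) hab
    (fun y hy => (Real.continuousAt_rpow_const y β
      (Or.inl (ha.trans_le hy.1).ne')).continuousWithinAt)
    (fun y hy => Real.hasDerivAt_rpow_const (Or.inl (ha.trans hy.1).ne'))
  refine ⟨ξ, hξ, ?_⟩
  rw [h, div_mul_cancel₀ _ (sub_pos.2 hab).ne']

/-- The mean value theorem twice: for y ↦ (y + 1)^β - y^β, then for y ↦ y^{β-1}. The difference is
taken in the order that makes it positive when 0 < β < 1. -/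
lemma exists_rpow_second_diff_eq (β : ℝ) {a : ℝ} (ha : 0 < a) :
    ∃ η ∈ Ioo a (a + 2), ((a + 1) ^ β - a ^ β) - ((a + 1 + 1) ^ β - (a + 1) ^ β) =
      β * (1 - β) * η ^ (β - 2) := by
  obtain ⟨ξ, hξ, h⟩ := exists_hasDerivAt_eq_slope (fun y : ℝ => (y + 1) ^ β - y ^ β)
    (fun y => β * (y + 1) ^ (β - 1) - β * y ^ (β - 1)) (lt_add_one a)
    (fun y hy => by
      have hy0 : 0 < y := ha.trans_le hy.1
      refine ContinuousAt.continuousWithinAt (ContinuousAt.sub ?_ ?_)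
      · exact ContinuousAt.rpow_const (by fun_prop) (Or.inl (by positivity))
      · exact Real.continuousAt_rpow_const y β (Or.inl hy0.ne'))
    (fun y hy => by
      have hy0 : 0 < y := ha.trans hy.1
      refine HasDerivAt.sub ?_ (Real.hasDerivAt_rpow_const (Or.inl hy0.ne'))
      have := ((hasDerivAt_id y).add_const 1).rpow_const (p := β)
        (Or.inl (by simp only [id_eq]; positivity))
      simpa using this)
  obtain ⟨η, hη, h'⟩ := exists_rpow_sub_eq (β - 1) (ha.trans hξ.1) (lt_add_one ξ)
  refine ⟨η, ⟨hξ.1.trans hη.1, by linarith [hη.2, hξ.2]⟩, ?_⟩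
  rw [add_sub_cancel_left, div_one] at h
  rw [add_sub_cancel_left, mul_one, show β - 1 - 1 = β - 2 by ring] at h'
  have : ((a + 1 + 1) ^ β - (a + 1) ^ β) - ((a + 1) ^ β - a ^ β) = β * ((β - 1) * η ^ (β - 2)) := by
    rw [← h', mul_sub, h]
  linear_combination -this

lemma rpow_succ_sub_nonneg {β : ℝ} (hβ : 0 < β) (k : ℕ) :
    0 ≤ ((k : ℝ) + 1) ^ β - (k : ℝ) ^ β :=
  sub_nonneg.2 (Real.rpow_le_rpow (by positivity) (by linarith) hβ.le)

lemma rpow_succ_sub_le {β : ℝ} (hβ : 0 < β) (hβ' : β < 1) {N k : ℕ} (hN : 0 < N) (hk : N ≤ k) :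
    ((k : ℝ) + 1) ^ β - (k : ℝ) ^ β ≤ (N : ℝ) ^ β / N := by
  have hN' : (0 : ℝ) < N := by exact_mod_cast hN
  have hk' : (N : ℝ) ≤ k := by exact_mod_cast hk
  obtain ⟨ξ, hξ, h⟩ := exists_rpow_sub_eq β (hN'.trans_le hk') (lt_add_one (k : ℝ))
  rw [h, add_sub_cancel_left, mul_one]
  have h1 : ξ ^ (β - 1) ≤ (N : ℝ) ^ (β - 1) :=
    Real.rpow_le_rpow_of_nonpos hN' (hk'.trans hξ.1.le) (by linarith)
  calc _ ≤ 1 * ξ ^ (β - 1) := by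
        have : 0 < ξ := by linarith [hξ.1]
        gcongr
    _ ≤ (N : ℝ) ^ (β - 1) := by rw [one_mul]; exact h1
    _ = _ := Real.rpow_sub_one hN'.ne' β

lemma rpow_second_diff_bounds {β : ℝ} (hβ : 0 < β) (hβ' : β < 1) {N k : ℕ} (hN : 0 < N)
    (hk : N ≤ k) (hk3 : k ≤ 3 * N) :
    β * (1 - β) / 25 * ((N : ℝ) ^ β / N ^ 2) ≤
      (((k : ℝ) + 1) ^ β - (k : ℝ) ^ β) - (((k : ℝ) + 1 + 1) ^ β - ((k : ℝ) + 1) ^ β) ∧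
    (((k : ℝ) + 1) ^ β - (k : ℝ) ^ β) - (((k : ℝ) + 1 + 1) ^ β - ((k : ℝ) + 1) ^ β) ≤
      (N : ℝ) ^ β / N ^ 2 := by
  have hN' : (1 : ℝ) ≤ N := by exact_mod_cast hN
  have hk' : (N : ℝ) ≤ k := by exact_mod_cast hk
  have hk3' : (k : ℝ) ≤ 3 * N := by exact_mod_cast hk3
  have hN0 : (0 : ℝ) < N := by linarith
  obtain ⟨η, hη, h⟩ := exists_rpow_second_diff_eq β (hN0.trans_le hk')
  rw [h]
  have hη0 : 0 < η := by linarith [hη.1]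
  have e : ∀ y : ℝ, 0 < y → y ^ (β - 2) = y ^ β / y ^ 2 := fun y hy => by
    rw [Real.rpow_sub hy, Real.rpow_two]
  have hb : 0 < β * (1 - β) := mul_pos hβ (by linarith)
  constructor
  · have h1 : (5 * (N : ℝ)) ^ (β - 2) ≤ η ^ (β - 2) :=
      Real.rpow_le_rpow_of_nonpos hη0 (by linarith [hη.2]) (by linarith)
    have h2 : (N : ℝ) ^ β / N ^ 2 / 25 ≤ (5 * (N : ℝ)) ^ (β - 2) := by
      rw [e _ (by positivity), Real.mul_rpow (by norm_num) hN0.le]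
      have : (1 : ℝ) ≤ 5 ^ β := Real.one_le_rpow (by norm_num) hβ.le
      calc (N : ℝ) ^ β / N ^ 2 / 25 = 1 * (N : ℝ) ^ β / (5 * N) ^ 2 := by rw [mul_pow]; ring
        _ ≤ _ := by gcongr
    calc _ = β * (1 - β) * ((N : ℝ) ^ β / N ^ 2 / 25) := by ring
      _ ≤ _ := mul_le_mul_of_nonneg_left (h2.trans h1) hb.le
  · have h1 : η ^ (β - 2) ≤ (N : ℝ) ^ (β - 2) :=
      Real.rpow_le_rpow_of_nonpos hN0 (hk'.trans hη.1.le) (by linarith)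
    rw [← e _ hN0]
    calc _ ≤ 1 * η ^ (β - 2) := by
          gcongr; nlinarith
      _ ≤ _ := by rw [one_mul]; exact h1

/-! ### A second-derivative test for exponential sums. -/

lemma abs_le_mul_norm_exp_sub_one {u : ℝ} (hu : |u| ≤ Real.pi) :
    |u| ≤ 2 * ‖Complex.exp (Complex.I * u) - 1‖ := by
  rw [Complex.norm_exp_I_mul_ofReal_sub_one, norm_mul, Real.norm_eq_abs, Real.norm_eq_abs, abs_two]
  have h2 := Real.mul_abs_le_abs_sin (x := u / 2) (by rw [abs_div, abs_two]; linarith)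
  have h4 : (1 / 2 : ℝ) ≤ 2 / Real.pi := by
    rw [div_le_div_iff₀ two_pos Real.pi_pos]; linarith [Real.pi_le_four]
  have h5 : 1 / 2 * |u / 2| ≤ 2 / Real.pi * |u / 2| := by gcongr
  rw [abs_div, abs_two] at h5 h2
  linarith

lemma norm_exp_I_sub (a b : ℝ) :
    ‖Complex.exp (Complex.I * a) - Complex.exp (Complex.I * b)‖ =
      ‖Complex.exp (Complex.I * (a - b : ℝ)) - 1‖ := by
  have : Complex.exp (Complex.I * a) - Complex.exp (Complex.I * b) =
      Complex.exp (Complex.I * b) * (Complex.exp (Complex.I * (a - b : ℝ)) - 1) := by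
    rw [mul_sub, mul_one, ← Complex.exp_add]; congr 2; push_cast; ring
  rw [this, norm_mul, Complex.norm_exp_I_mul_ofReal, one_mul]

lemma norm_exp_I_sub_le (a b : ℝ) :
    ‖Complex.exp (Complex.I * a) - Complex.exp (Complex.I * b)‖ ≤ |a - b| := by
  rw [norm_exp_I_sub, ← Real.norm_eq_abs]
  exact Real.norm_exp_I_mul_ofReal_sub_one_le

/-- A regularisation of `z ↦ z⁻¹` at scale `τ`. -/
def regInv (τ : ℝ) (z : ℂ) : ℂ := (starRingEnd ℂ) z / ((‖z‖ ^ 2 + τ ^ 2 : ℝ) : ℂ)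

lemma norm_regInv_le {τ : ℝ} (hτ : 0 < τ) (z : ℂ) : ‖regInv τ z‖ ≤ 1 / τ := by
  have h : 0 < ‖z‖ ^ 2 + τ ^ 2 := by positivity
  rw [regInv, norm_div, RCLike.norm_conj, Complex.norm_real, Real.norm_of_nonneg h.le,
    div_le_div_iff₀ h hτ]
  nlinarith [sq_nonneg (‖z‖ - τ), norm_nonneg z]

lemma norm_regInv_sub_le {τ : ℝ} (hτ : 0 < τ) (z w : ℂ) :
    ‖regInv τ z - regInv τ w‖ ≤ 2 * ‖z - w‖ / τ ^ 2 := by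
  have hz : 0 < ‖z‖ ^ 2 + τ ^ 2 := by positivity
  have hw : 0 < ‖w‖ ^ 2 + τ ^ 2 := by positivity
  have hz' : ((‖z‖ ^ 2 + τ ^ 2 : ℝ) : ℂ) ≠ 0 := by exact_mod_cast hz.ne'
  have hw' : ((‖w‖ ^ 2 + τ ^ 2 : ℝ) : ℂ) ≠ 0 := by exact_mod_cast hw.ne'
  have e : regInv τ z - regInv τ w = ((τ : ℂ) ^ 2 * (starRingEnd ℂ) (z - w) +
      (starRingEnd ℂ) z * (starRingEnd ℂ) w * (w - z)) /
      (((‖z‖ ^ 2 + τ ^ 2 : ℝ) : ℂ) * ((‖w‖ ^ 2 + τ ^ 2 : ℝ) : ℂ)) := by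
    rw [regInv, regInv, div_sub_div _ _ hz' hw']
    congr 1
    push_cast
    rw [← Complex.conj_mul', ← Complex.conj_mul', map_sub]
    ring
  rw [e, norm_div, norm_mul (((‖z‖ ^ 2 + τ ^ 2 : ℝ) : ℂ)), Complex.norm_real, Complex.norm_real,
    Real.norm_of_nonneg hz.le, Real.norm_of_nonneg hw.le, div_le_div_iff₀ (by positivity)
    (by positivity)]
  have h1 : ‖(τ : ℂ) ^ 2 * (starRingEnd ℂ) (z - w) +
      (starRingEnd ℂ) z * (starRingEnd ℂ) w * (w - z)‖ ≤ (τ ^ 2 + ‖z‖ * ‖w‖) * ‖z - w‖ := by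
    refine (norm_add_le _ _).trans ?_
    rw [norm_mul, norm_mul, norm_mul, RCLike.norm_conj, RCLike.norm_conj, RCLike.norm_conj,
      norm_pow, Complex.norm_real, Real.norm_of_nonneg hτ.le, norm_sub_rev w z]
    linarith
  have h2 : (τ ^ 2 + ‖z‖ * ‖w‖) * τ ^ 2 ≤ 2 * ((‖z‖ ^ 2 + τ ^ 2) * (‖w‖ ^ 2 + τ ^ 2)) := by
    nlinarith [sq_nonneg (‖z‖ - ‖w‖), mul_nonneg (sq_nonneg ‖z‖) (sq_nonneg ‖w‖), sq_nonneg (τ ^ 2),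
      mul_nonneg (sq_nonneg τ) (sq_nonneg (‖z‖ - ‖w‖)), mul_nonneg (sq_nonneg τ) (sq_nonneg ‖z‖),
      mul_nonneg (sq_nonneg τ) (sq_nonneg ‖w‖)]
  calc _ ≤ (τ ^ 2 + ‖z‖ * ‖w‖) * ‖z - w‖ * τ ^ 2 := by gcongr
    _ = (τ ^ 2 + ‖z‖ * ‖w‖) * τ ^ 2 * ‖z - w‖ := by ring
    _ ≤ 2 * ((‖z‖ ^ 2 + τ ^ 2) * (‖w‖ ^ 2 + τ ^ 2)) * ‖z - w‖ := by gcongr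
    _ = _ := by ring

/-- A smooth partition of unity: the first term lives where |z| ≲ τ, and the second supplies the
factor z needed for summation by parts. It replaces a sharp splitting of the index range around the
stationary point. -/
lemma one_eq_regInv (τ : ℝ) (hτ : 0 < τ) (z : ℂ) :
    (1 : ℂ) = ((τ ^ 2 / (‖z‖ ^ 2 + τ ^ 2) : ℝ) : ℂ) + regInv τ z * z := by
  have hz : 0 < ‖z‖ ^ 2 + τ ^ 2 := by positivity
  have hz' : ((‖z‖ ^ 2 + τ ^ 2 : ℝ) : ℂ) ≠ 0 := by exact_mod_cast hz.ne'
  rw [regInv, div_mul_eq_mul_div, Complex.conj_mul', Complex.ofReal_div, ← add_div, eq_div_iff hz']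
  push_cast; ring

/-- Abel summation moves the difference onto `g`; at most 3N increments of size A/N remain. -/
lemma IsBump.norm_sum_mul_sub_le {N : ℕ} {A : ℝ} {g : ℕ → ℂ} (hg : IsBump N A g) {E : ℕ → ℂ}
    (hE : ∀ k, ‖E k‖ ≤ 1) (hN : 0 < N) :
    ‖∑ k ∈ Finset.range (3 * N), g k * (E (k + 1) - E k)‖ ≤ 3 * A := by
  have hN' : (0 : ℝ) < N := by exact_mod_cast hN
  have h1 : ∑ k ∈ Finset.range (3 * N), g k * (E (k + 1) - E k) =
      -∑ k ∈ Finset.range (3 * N), (g (k + 1) - g k) * E (k + 1) := by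
    have h2 := Finset.sum_range_sub (fun k => g k * E k) (3 * N)
    rw [hg.eq_zero_of_le 0 (by omega), hg.eq_zero_of_ge _ le_rfl] at h2
    rw [eq_neg_iff_add_eq_zero, ← Finset.sum_add_distrib]
    simp only [zero_mul, sub_zero] at h2
    rw [← h2]
    exact Finset.sum_congr rfl fun k _ => by ring
  rw [h1, norm_neg]
  calc _ ≤ ∑ k ∈ Finset.range (3 * N), A / N := by
        refine norm_sum_le_of_le _ fun k _ => ?_
        rw [norm_mul]
        calc _ ≤ A / N * 1 := by
              gcongr
              · exact div_nonneg hg.nonneg hN'.le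
              · exact hg.norm_sub_le k
              · exact hE _
          _ = _ := mul_one _
    _ = 3 * A := by
        rw [Finset.sum_const, Finset.card_range, nsmul_eq_mul]; push_cast; field_simp

/-- A set of indices on which a sequence with increments at least `σ` varies by at most `D` has at
most `1 + D / σ` elements. -/
lemma card_le_of_increasing {θ : ℕ → ℝ} {a b : ℕ} {σ D : ℝ} (hσ : 0 < σ) (hD : 0 ≤ D)
    (hθ : ∀ k, a ≤ k → k < b → σ ≤ θ (k + 1) - θ k) (B : Finset ℕ)
    (hB : ∀ k ∈ B, a ≤ k ∧ k ≤ b)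
    (hBD : ∀ k ∈ B, ∀ l ∈ B, k ≤ l → θ l - θ k ≤ D) :
    (B.card : ℝ) ≤ 1 + D / σ := by
  rcases B.eq_empty_or_nonempty with rfl | hne
  · simp; positivity
  set k := B.min' hne
  set l := B.max' hne
  have hk : k ∈ B := B.min'_mem hne
  have hl : l ∈ B := B.max'_mem hne
  have hkl : k ≤ l := B.min'_le _ hl
  have hmono : ∀ n, k + n ≤ b → σ * n ≤ θ (k + n) - θ k := by
    intro n
    induction n with
    | zero => intro _; simp
    | succ n ih =>
      intro hn
      have h1 := ih (by omega)
      have h2 := hθ (k + n) (by have := (hB k hk).1; omega) (by omega)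
      push_cast
      rw [← add_assoc]; linarith
  have h1 := hmono (l - k) (by have := (hB l hl).2; omega)
  rw [Nat.add_sub_cancel' hkl] at h1
  have h2 : ((l - k : ℕ) : ℝ) ≤ D / σ := by
    rw [le_div_iff₀ hσ]; linarith [hBD k hk l hl hkl]
  have h3 : B ⊆ Finset.Icc k l := fun i hi => Finset.mem_Icc.2 ⟨B.min'_le _ hi, B.le_max' _ hi⟩
  have h4 := Finset.card_le_card h3
  rw [Nat.card_Icc] at h4
  have h5 : B.card ≤ 1 + (l - k) := by omega
  calc (B.card : ℝ) ≤ ((1 + (l - k) : ℕ) : ℝ) := by exact_mod_cast h5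
    _ = 1 + ((l - k : ℕ) : ℝ) := by push_cast; ring
    _ ≤ _ := by linarith

/-- A second-derivative test for the exponential sums with phase `kx - t k^β`. -/
lemma exists_norm_expSum_le {β : ℝ} (hβ : 0 < β) (hβ' : β < 1) :
    ∃ C : ℝ, 0 < C ∧ ∀ (N J : ℕ) (t : ℝ), 0 < J → (J : ℝ) ^ 8 ≤ t * (N : ℝ) ^ β →
      t * (N : ℝ) ^ β ≤ 2 * (J : ℝ) ^ 8 → 2 * J ^ 8 ≤ N → ∀ (A : ℝ) (c : ℕ → ℂ), IsBump N A c →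
      ∀ x : ℝ, ‖∑ k ∈ Finset.range (3 * N),
        c k * Complex.exp (Complex.I * ((k : ℝ) * x - t * (k : ℝ) ^ β : ℝ))‖ ≤ C * A * N / J := by
  set γ : ℝ := β * (1 - β) / 25 with hγ
  have hγ0 : 0 < γ := by
    have : 0 < β * (1 - β) := mul_pos hβ (by linarith)
    positivity
  -- In units of AN/J: 1 + 4/γ from the indices near the stationary point, 3 from the tail of the
  -- first weight, and 24 from the summation by parts.
  refine ⟨28 + 4 / γ, by positivity, fun N J t hJ ht ht' hJN A c hc x => ?_⟩
  have hJ1 : 1 ≤ J ^ 8 := Nat.one_le_pow _ _ hJ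
  have hN : 0 < N := by omega
  have hN' : (0 : ℝ) < N := by exact_mod_cast hN
  have hJ' : (1 : ℝ) ≤ J := by exact_mod_cast hJ
  have hJ0 : (0 : ℝ) < J := by linarith
  have hA := hc.nonneg
  have hJN' : 2 * (J : ℝ) ^ 8 ≤ N := by exact_mod_cast hJN
  set φ : ℕ → ℝ := fun k => (k : ℝ) * x - t * (k : ℝ) ^ β with hφ
  set E : ℕ → ℂ := fun k => Complex.exp (Complex.I * (φ k : ℝ)) with hE
  set θ : ℕ → ℝ := fun k => φ (k + 1) - φ k with hθ
  set z : ℕ → ℂ := fun k => Complex.exp (Complex.I * (θ k : ℝ)) - 1 with hz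
  have hE1 : ∀ k, ‖E k‖ = 1 := fun k => Complex.norm_exp_I_mul_ofReal _
  have hzE : ∀ k, E (k + 1) - E k = z k * E k := by
    intro k
    simp only [hE, hz, hθ]
    rw [sub_mul, one_mul, ← Complex.exp_add]; congr 2; push_cast; ring
  have hN2 : (0 : ℝ) < (N : ℝ) ^ 2 := by positivity
  have hθ1 : ∀ k, N ≤ k → k ≤ 3 * N → γ * ((J : ℝ) ^ 8 / N ^ 2) ≤ θ (k + 1) - θ k ∧
      θ (k + 1) - θ k ≤ 2 * (J : ℝ) ^ 8 / N ^ 2 := by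
    intro k hk hk3
    have e : θ (k + 1) - θ k = t * ((((k : ℝ) + 1) ^ β - (k : ℝ) ^ β) -
        (((k : ℝ) + 1 + 1) ^ β - ((k : ℝ) + 1) ^ β)) := by
      simp only [hθ, hφ]; push_cast; ring
    have ht0 : 0 ≤ t := by
      by_contra hneg
      have : 0 < (N : ℝ) ^ β := by positivity
      have h2 : t * (N : ℝ) ^ β < 0 := mul_neg_of_neg_of_pos (not_le.1 hneg) this
      have : (0 : ℝ) < (J : ℝ) ^ 8 := by positivity
      linarith
    obtain ⟨h1, h2⟩ := rpow_second_diff_bounds hβ hβ' hN hk hk3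
    rw [e]
    constructor
    · calc _ ≤ γ * (t * (N : ℝ) ^ β / N ^ 2) := by gcongr
        _ = t * (γ * ((N : ℝ) ^ β / N ^ 2)) := by ring
        _ ≤ _ := mul_le_mul_of_nonneg_left h1 ht0
    · calc _ ≤ t * ((N : ℝ) ^ β / N ^ 2) := mul_le_mul_of_nonneg_left h2 ht0
        _ = t * (N : ℝ) ^ β / N ^ 2 := by ring
        _ ≤ _ := by gcongr
  -- The phase increments θ grow by about J^8/N² per step. These scales leave O(N/J) indices with
  -- |z| ≤ ρ, make τ²/ρ² = J^{-2}, and give the regularised inverse size and variation O(N/J^4).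
  -- Every contribution thus gains at least 1/J, with integer powers only.
  set τ : ℝ := (J : ℝ) ^ 6 / N with hτ
  have hτ0 : 0 < τ := by positivity
  set ρ : ℝ := (J : ℝ) ^ 7 / N with hρ
  have hρ0 : 0 < ρ := by positivity
  -- the part away from the stationary point, summed by parts
  have hb : IsBump N (2 * A * (4 * N / (J : ℝ) ^ 4)) (fun k => regInv τ (z k) * c k) := by
    refine hc.mul (fun k _ _ => (norm_regInv_le hτ0 _).trans ?_) (fun k hk hk3 => ?_)
    · rw [hτ, one_div, inv_div, div_le_div_iff₀ (by positivity) (by positivity)]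
      have h1 : (J : ℝ) ^ 4 ≤ (J : ℝ) ^ 6 := pow_le_pow_right₀ hJ' (by norm_num)
      nlinarith [pow_pos hJ0 6]
    · have h1 : ‖z (k + 1) - z k‖ ≤ 2 * (J : ℝ) ^ 8 / N ^ 2 := by
        simp only [hz, sub_sub_sub_cancel_right]
        refine (norm_exp_I_sub_le _ _).trans ?_
        obtain ⟨h2, h3⟩ := hθ1 k hk hk3.le
        rw [abs_of_nonneg ((by positivity : 0 ≤ γ * ((J : ℝ) ^ 8 / N ^ 2)).trans h2)]
        exact h3
      calc _ ≤ 2 * ‖z (k + 1) - z k‖ / τ ^ 2 := norm_regInv_sub_le hτ0 _ _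
        _ ≤ 2 * (2 * (J : ℝ) ^ 8 / N ^ 2) / τ ^ 2 := by gcongr
        _ = 4 * N / (J : ℝ) ^ 4 / N := by rw [hτ]; field_simp; norm_num
  have hS2 := hb.norm_sum_mul_sub_le (E := E) (fun k => (hE1 k).le) hN
  -- the indices near the stationary point
  set B : Finset ℕ := (Finset.Ioo N (3 * N)).filter fun k => ‖z k‖ ≤ ρ with hB
  have hBcard : (B.card : ℝ) ≤ 1 + 4 * ρ / (γ * ((J : ℝ) ^ 8 / N ^ 2)) := by
    refine card_le_of_increasing (θ := θ) (a := N) (b := 3 * N) (by positivity) (by positivity)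
      (fun k hk hk3 => (hθ1 k hk hk3.le).1) B (fun k hk => ?_) (fun k hk l hl hkl => ?_)
    · have := Finset.mem_Ioo.1 (Finset.mem_filter.1 hk).1
      omega
    · obtain ⟨hk1, hk2⟩ := Finset.mem_filter.1 hk
      obtain ⟨hl1, hl2⟩ := Finset.mem_filter.1 hl
      rw [Finset.mem_Ioo] at hk1 hl1
      have hup : ∀ n, k + n ≤ 3 * N → 0 ≤ θ (k + n) - θ k ∧
          θ (k + n) - θ k ≤ 2 * (J : ℝ) ^ 8 / N ^ 2 * n := by
        intro n
        induction n with
        | zero => intro _; simp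
        | succ n ih =>
          intro hn
          have h1 := ih (by omega)
          have h2 := hθ1 (k + n) (by omega) (by omega)
          have h3 : 0 ≤ γ * ((J : ℝ) ^ 8 / N ^ 2) := by positivity
          push_cast
          rw [← add_assoc]; constructor <;> linarith
      obtain ⟨h1, h2⟩ := hup (l - k) (by omega)
      rw [Nat.add_sub_cancel' hkl] at h1 h2
      have h3 : ((l - k : ℕ) : ℝ) ≤ 3 * N := by exact_mod_cast (by omega : l - k ≤ 3 * N)
      -- The assumption 2J^8 ≤ N keeps the total variation of θ below π, so e^{iθ} does not wrap
      -- around the circle and small chords mean small arcs.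
      have h4 : θ l - θ k ≤ 3 := by
        calc _ ≤ 2 * (J : ℝ) ^ 8 / N ^ 2 * (3 * N) := h2.trans (by gcongr)
          _ ≤ N / N ^ 2 * (3 * N) := by gcongr
          _ = 3 := by field_simp
      have h5 := abs_le_mul_norm_exp_sub_one (u := θ l - θ k)
        (by rw [abs_of_nonneg h1]; linarith [Real.pi_gt_three])
      rw [abs_of_nonneg h1, ← norm_exp_I_sub] at h5
      have h6 : ‖Complex.exp (Complex.I * (θ l : ℝ)) - Complex.exp (Complex.I * (θ k : ℝ))‖ ≤
          ρ + ρ := by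
        have : Complex.exp (Complex.I * (θ l : ℝ)) - Complex.exp (Complex.I * (θ k : ℝ)) =
          z l - z k := by simp only [hz]; ring
        rw [this]
        exact (norm_sub_le _ _).trans (add_le_add hl2 hk2)
      linarith
  have hS1 : ‖∑ k ∈ Finset.range (3 * N),
      ((τ ^ 2 / (‖z k‖ ^ 2 + τ ^ 2) : ℝ) : ℂ) * (c k * E k)‖ ≤
      A * (B.card + 3 * N * (τ ^ 2 / ρ ^ 2)) := by
    have hle : ∀ k ∈ Finset.range (3 * N), ‖((τ ^ 2 / (‖z k‖ ^ 2 + τ ^ 2) : ℝ) : ℂ) * (c k * E k)‖ ≤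
        A * ((if k ∈ B then 1 else 0) + τ ^ 2 / ρ ^ 2) := by
      intro k _
      have h0 : 0 < ‖z k‖ ^ 2 + τ ^ 2 := by positivity
      have h00 : 0 ≤ τ ^ 2 / ρ ^ 2 := by positivity
      rw [norm_mul, norm_mul, hE1, mul_one, Complex.norm_real,
        Real.norm_of_nonneg (by positivity), mul_comm]
      by_cases hk : N < k ∧ k < 3 * N
      · refine mul_le_mul (hc.norm_le k) ?_ (by positivity) hA
        by_cases hkB : k ∈ B
        · rw [if_pos hkB]
          have : τ ^ 2 / (‖z k‖ ^ 2 + τ ^ 2) ≤ 1 := (div_le_one h0).2 (by nlinarith [sq_nonneg ‖z k‖])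
          linarith
        · rw [if_neg hkB, zero_add]
          have h1 : ρ < ‖z k‖ := by
            by_contra hcon
            exact hkB (Finset.mem_filter.2 ⟨Finset.mem_Ioo.2 hk, not_lt.1 hcon⟩)
          gcongr
          nlinarith [sq_nonneg τ]
      · have : c k = 0 := by
          by_cases h1 : k ≤ N
          · exact hc.eq_zero_of_le k h1
          · exact hc.eq_zero_of_ge k (by omega)
        rw [this, norm_zero, zero_mul]
        refine mul_nonneg hA (add_nonneg ?_ h00)
        split_ifs <;> norm_num
    refine (norm_sum_le_of_le _ hle).trans ?_
    rw [← Finset.mul_sum, Finset.sum_add_distrib]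
    have hcard : (∑ k ∈ Finset.range (3 * N), if k ∈ B then (1 : ℝ) else 0) ≤ B.card := by
      rw [Finset.sum_ite_mem, Finset.sum_const, nsmul_eq_mul, mul_one]
      exact_mod_cast Finset.card_le_card Finset.inter_subset_right
    refine mul_le_mul_of_nonneg_left (add_le_add hcard ?_) hA
    simp
  -- Insert the partition of unity and use z_k E_k = E_{k+1} - E_k in its second part.
  have hsplit : ∑ k ∈ Finset.range (3 * N), c k * E k =
      (∑ k ∈ Finset.range (3 * N), ((τ ^ 2 / (‖z k‖ ^ 2 + τ ^ 2) : ℝ) : ℂ) * (c k * E k)) +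
      ∑ k ∈ Finset.range (3 * N), regInv τ (z k) * c k * (E (k + 1) - E k) := by
    rw [← Finset.sum_add_distrib]
    refine Finset.sum_congr rfl fun k _ => ?_
    rw [hzE]
    linear_combination (c k * E k) * one_eq_regInv τ hτ0 (z k)
  rw [hsplit]
  refine (norm_add_le _ _).trans ((add_le_add hS1 hS2).trans ?_)
  have e1 : 4 * ρ / (γ * ((J : ℝ) ^ 8 / N ^ 2)) = 4 / γ * (N / J) := by
    rw [hρ]; field_simp
  have e2 : τ ^ 2 / ρ ^ 2 = 1 / (J : ℝ) ^ 2 := by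
    rw [hτ, hρ]; field_simp
  have h1 : 1 ≤ (N : ℝ) / J := by
    rw [one_le_div hJ0]
    calc (J : ℝ) ≤ (J : ℝ) ^ 8 := le_self_pow₀ hJ' (by norm_num)
      _ ≤ N := by nlinarith [pow_pos hJ0 8]
  have h2 : 1 / (J : ℝ) ^ 2 ≤ 1 / J := by
    gcongr; exact le_self_pow₀ hJ' (by norm_num)
  have h4 : 4 * (N : ℝ) / (J : ℝ) ^ 4 ≤ 4 * (N / J) := by
    rw [mul_div_assoc]; gcongr; exact le_self_pow₀ hJ' (by norm_num)
  rw [e1] at hBcard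
  calc _ ≤ A * ((N / J + 4 / γ * (N / J)) + 3 * N * (1 / J)) + 3 * (2 * A * (4 * (N / J))) := by
        rw [e2]
        gcongr
        exact hBcard.trans (by linarith)
    _ = _ := by ring

/-! ### Coefficients of the wave packet. -/

/-- The tent function of height one supported on `[N, 3N]`. -/
def tent (N k : ℕ) : ℝ := max 0 (1 - |(k : ℝ) - 2 * N| / N)

lemma tent_nonneg (N k : ℕ) : 0 ≤ tent N k := le_max_left _ _

lemma tent_le_one (N k : ℕ) : tent N k ≤ 1 :=
  max_le zero_le_one (sub_le_self _ (by positivity))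

lemma isBump_tent {N : ℕ} (hN : 0 < N) : IsBump N 1 (fun k => (tent N k : ℂ)) := by
  have hN' : (0 : ℝ) < N := by exact_mod_cast hN
  refine ⟨fun k => ?_, fun k => ?_, fun k hk => ?_, fun k hk => ?_⟩
  · rw [Complex.norm_real, Real.norm_of_nonneg (tent_nonneg N k)]; exact tent_le_one N k
  · rw [← Complex.ofReal_sub, Complex.norm_real, Real.norm_eq_abs, tent, tent]
    rw [max_comm (0 : ℝ), max_comm (0 : ℝ)]
    refine (abs_max_sub_max_le_abs _ _ 0).trans ?_
    rw [sub_sub_sub_cancel_left, ← sub_div, abs_div, abs_of_pos hN']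
    gcongr
    refine (abs_abs_sub_abs_le_abs_sub _ _).trans_eq ?_
    push_cast
    rw [show (k : ℝ) - 2 * N - (k + 1 - 2 * N) = -1 by ring]; simp
  · have hk' : (k : ℝ) ≤ N := by exact_mod_cast hk
    have : tent N k = 0 := by
      refine max_eq_left (sub_nonpos.2 ((one_le_div hN').2 ?_))
      rw [abs_of_nonpos (by linarith)]; linarith
    simp [this]
  · have hk' : 3 * (N : ℝ) ≤ k := by exact_mod_cast hk
    have : tent N k = 0 := by
      refine max_eq_left (sub_nonpos.2 ((one_le_div hN').2 ?_))
      rw [abs_of_nonneg (by linarith)]; linarith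
    simp [this]

/-- The coefficients at time `s` of the solution of `∂ₛ w = 𝓛 w` that is concentrated at time `t`,
for the dispersion relation `k^β`. -/
def waveCoeff (β : ℝ) (N : ℕ) (t s : ℝ) (k : ℕ) : ℂ :=
  Complex.exp (Complex.I * ((s - t) * (k : ℝ) ^ β : ℝ)) * tent N k

/-- The phase (s - t)k^β changes by at most |s - t| N^β / N ≤ K/N per step. Dispersion thus costs a
factor K, and only a constant while |s - t| ≤ N^{-β}. -/
lemma isBump_waveCoeff {β : ℝ} (hβ : 0 < β) (hβ' : β < 1) {N : ℕ} (hN : 0 < N) {t s K : ℝ}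
    (hK : 1 ≤ K) (hst : |s - t| * (N : ℝ) ^ β ≤ K) : IsBump N (2 * K) (waveCoeff β N t s) := by
  have h := (isBump_tent hN).mul (B := K)
    (m := fun k => Complex.exp (Complex.I * ((s - t) * (k : ℝ) ^ β : ℝ)))
    (fun k _ _ => by rw [Complex.norm_exp_I_mul_ofReal]; exact hK) (fun k hk _ => ?_)
  · rw [mul_one] at h; exact h
  · refine (norm_exp_I_sub_le _ _).trans ?_
    push_cast
    rw [← mul_sub, abs_mul, abs_of_nonneg (rpow_succ_sub_nonneg hβ k)]
    calc _ ≤ |s - t| * ((N : ℝ) ^ β / N) := by gcongr; exact rpow_succ_sub_le hβ hβ' hN hk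
      _ = |s - t| * (N : ℝ) ^ β / N := by ring
      _ ≤ K / N := by gcongr

lemma IsBump.mul_frequency {β : ℝ} (hβ : 0 < β) (hβ' : β < 1) {N : ℕ} (hN : 0 < N) {A : ℝ}
    {c : ℕ → ℂ} (hc : IsBump N A c) :
    IsBump N (6 * A * (N : ℝ) ^ β) (fun k => Complex.I * ((k : ℝ) ^ β : ℝ) * c k) := by
  have hN' : (0 : ℝ) < N := by exact_mod_cast hN
  have h := hc.mul (B := 3 * (N : ℝ) ^ β) (m := fun k => Complex.I * ((k : ℝ) ^ β : ℝ))
    (fun k hk hk3 => ?_) (fun k hk _ => ?_)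
  · refine h.mono (le_of_eq (by ring))
  · rw [norm_mul, Complex.norm_I, one_mul, Complex.norm_real, Real.norm_of_nonneg (by positivity)]
    have hk3' : (k : ℝ) ≤ 3 * N := by exact_mod_cast hk3
    calc (k : ℝ) ^ β ≤ (3 * N) ^ β := by gcongr
      _ = 3 ^ β * (N : ℝ) ^ β := Real.mul_rpow (by norm_num) hN'.le
      _ ≤ 3 * (N : ℝ) ^ β := by
        gcongr
        calc (3 : ℝ) ^ β ≤ 3 ^ (1 : ℝ) := Real.rpow_le_rpow_of_exponent_le (by norm_num) hβ'.le
          _ = 3 := Real.rpow_one _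
  · rw [← mul_sub, norm_mul, Complex.norm_I, one_mul, ← Complex.ofReal_sub, Complex.norm_real]
    push_cast
    rw [Real.norm_of_nonneg (rpow_succ_sub_nonneg hβ k)]
    refine (rpow_succ_sub_le hβ hβ' hN hk).trans ?_
    gcongr
    linarith [Real.rpow_nonneg hN'.le β]

lemma IsBump.const_mul {N : ℕ} {A : ℝ} {c : ℕ → ℂ} (hc : IsBump N A c) {a : ℂ} (ha : ‖a‖ ≤ 1) :
    IsBump N A (fun k => a * c k) := by
  refine ⟨fun k => ?_, fun k => ?_, fun k hk => by simp [hc.eq_zero_of_le k hk],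
    fun k hk => by simp [hc.eq_zero_of_ge k hk]⟩
  · rw [norm_mul]
    exact (mul_le_of_le_one_left (norm_nonneg _) ha).trans (hc.norm_le k)
  · rw [← mul_sub, norm_mul]
    exact (mul_le_of_le_one_left (norm_nonneg _) ha).trans (hc.norm_sub_le k)

/-! ### Besov norms of the packets. -/

section Besov

variable {ψ : ℝ → ℝ}

lemma IsCutoff.hasCompactSupport (hψ : IsCutoff ψ) : HasCompactSupport ψ :=
  (isCompact_closedBall (0 : ℝ) 1).of_isClosed_subset (isClosed_tsupport ψ)
    (hψ.tsupport_subset.trans Metric.ball_subset_closedBall)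

lemma IsCutoff.eq_zero (hψ : IsCutoff ψ) {ξ : ℝ} (hξ : 1 ≤ ξ) : ψ ξ = 0 := by
  by_contra h
  have := hψ.tsupport_subset (subset_tsupport ψ (Function.mem_support.2 h))
  rw [mem_ball_zero_iff, Real.norm_eq_abs] at this
  linarith [le_abs_self ξ]

lemma IsCutoff.dyadicSymbol_neg (hψ : IsCutoff ψ) (q : ℤ) (ξ : ℝ) :
    dyadicSymbol ψ q (-ξ) = dyadicSymbol ψ q ξ := by
  simp only [dyadicSymbol, neg_mul, hψ.even]

lemma IsCutoff.dyadicSymbol_eq_zero (hψ : IsCutoff ψ) {m n k : ℕ} (hk : 2 ^ m < k)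
    (hk3 : k < 3 * 2 ^ m) (h1 : n ≠ m + 1) (h2 : n ≠ m + 2) :
    dyadicSymbol ψ ((n : ℤ) - 1) (k : ℝ) = 0 := by
  have hk' : (2 : ℝ) ^ m < k := by exact_mod_cast hk
  have hk3' : (k : ℝ) < 3 * 2 ^ m := by exact_mod_cast hk3
  have hk0 : (0 : ℝ) < k := (by positivity : (0 : ℝ) < 2 ^ m).trans hk'
  unfold dyadicSymbol
  rcases Nat.eq_zero_or_pos n with rfl | hn
  · have : (1 : ℝ) ≤ 2 ^ m := one_le_pow₀ (by norm_num)
    simp [hψ.eq_zero (this.trans hk'.le)]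
  · rw [if_neg (by omega)]
    obtain ⟨q, rfl⟩ : ∃ q, n = q + 1 := ⟨n - 1, by omega⟩
    have e1 : (-((((q + 1 : ℕ) : ℤ) - 1) + 1) : ℤ) = -((q + 1 : ℕ) : ℤ) := by push_cast; ring
    have e2 : (-(((q + 1 : ℕ) : ℤ) - 1) : ℤ) = -((q : ℕ) : ℤ) := by push_cast; ring
    rw [e1, e2, zpow_neg, zpow_natCast, zpow_neg, zpow_natCast, ← div_eq_mul_inv,
      ← div_eq_mul_inv]
    rcases lt_or_ge q m with hq | hq
    · have h3 : (2 : ℝ) ^ (q + 1) ≤ 2 ^ m := pow_le_pow_right₀ (by norm_num) hq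
      have h4 : (2 : ℝ) ^ q ≤ 2 ^ m := pow_le_pow_right₀ (by norm_num) hq.le
      rw [hψ.eq_zero ((one_le_div (by positivity)).2 (by linarith)),
        hψ.eq_zero ((one_le_div (by positivity)).2 (by linarith)), sub_zero]
    · have hq2 : m + 2 ≤ q := by omega
      have h3 : (2 : ℝ) ^ (m + 2) ≤ 2 ^ q := pow_le_pow_right₀ (by norm_num) hq2
      have h5 : (2 : ℝ) ^ q ≤ 2 ^ (q + 1) := pow_le_pow_right₀ (by norm_num) (by omega)
      have h6 : (2 : ℝ) ^ (m + 2) = 4 * 2 ^ m := by ring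
      have one : ∀ y : ℝ, (2 : ℝ) ^ q ≤ y → ψ (k / y) = 1 := by
        intro y hy
        have hy0 : 0 < y := (by positivity : (0 : ℝ) < 2 ^ q).trans_le hy
        apply hψ.eq_one
        rw [mem_ball_zero_iff, Real.norm_of_nonneg (by positivity), div_lt_iff₀ hy0]
        linarith
      rw [one _ h5, one _ le_rfl, sub_self]

/-- For q ≥ m the rescaled cutoffs have Lipschitz constant at most L·2^{-m}, so the symbol varies
slowly at the scale of the bump and the constant does not depend on q. -/
lemma IsCutoff.exists_isBump_dyadicSymbol_mul (hψ : IsCutoff ψ) :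
    ∃ B : ℝ, 0 < B ∧ ∀ (m q : ℕ), m ≤ q → ∀ (A : ℝ) (c : ℕ → ℂ), IsBump (2 ^ m) A c →
      IsBump (2 ^ m) (B * A) (fun k => (dyadicSymbol ψ (q : ℤ) (k : ℝ) : ℂ) * c k) := by
  obtain ⟨L, hL⟩ := (hψ.smooth.of_le (by simp)).lipschitzWith_of_hasCompactSupport
    hψ.hasCompactSupport one_ne_zero
  obtain ⟨P, hP⟩ := hψ.smooth.continuous.bounded_above_of_compact_support hψ.hasCompactSupport
  have hP0 : 0 ≤ P := (norm_nonneg _).trans (hP 0)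
  refine ⟨2 * (2 * P + 2 * L + 1), by positivity, fun m q hmq A c hc => ?_⟩
  have e : ∀ k : ℕ, dyadicSymbol ψ (q : ℤ) (k : ℝ) =
      ψ (k * (2 : ℝ) ^ (-((q : ℤ) + 1))) - ψ (k * (2 : ℝ) ^ (-(q : ℤ))) := fun k => by
    rw [dyadicSymbol, if_neg (by omega)]
  have h2 : (2 : ℝ) ^ (-(q : ℤ)) ≤ 1 / ((2 ^ m : ℕ) : ℝ) := by
    rw [zpow_neg, zpow_natCast, one_div]; push_cast
    gcongr; norm_num
  have h1 : (2 : ℝ) ^ (-((q : ℤ) + 1)) ≤ 1 / ((2 ^ m : ℕ) : ℝ) :=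
    le_trans (zpow_le_zpow_right₀ (by norm_num) (by omega)) h2
  have hdiff : ∀ (k : ℕ) (y : ℝ), 0 ≤ y → y ≤ 1 / ((2 ^ m : ℕ) : ℝ) →
      |ψ ((k + 1 : ℕ) * y) - ψ (k * y)| ≤ L * (1 / ((2 ^ m : ℕ) : ℝ)) := by
    intro k y hy hy'
    have h := hL.dist_le_mul ((k + 1 : ℕ) * y) (k * y)
    rw [Real.dist_eq, Real.dist_eq] at h
    refine h.trans ?_
    have : ((k + 1 : ℕ) : ℝ) * y - k * y = y := by push_cast; ring
    rw [this, abs_of_nonneg hy]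
    gcongr
  refine (hc.mul (B := 2 * P + 2 * L + 1)
    (m := fun k => (dyadicSymbol ψ (q : ℤ) (k : ℝ) : ℂ)) (fun k _ _ => ?_)
    (fun k _ _ => ?_)).mono (le_of_eq (by ring))
  · rw [Complex.norm_real, e]
    refine (norm_sub_le _ _).trans ?_
    linarith [hP (k * (2 : ℝ) ^ (-((q : ℤ) + 1))), hP (k * (2 : ℝ) ^ (-(q : ℤ))), L.coe_nonneg]
  · rw [← Complex.ofReal_sub, Complex.norm_real, e, e, Real.norm_eq_abs, sub_sub_sub_comm]
    refine (abs_sub _ _).trans ?_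
    have h3 := hdiff k _ (by positivity) h1
    have h4 := hdiff k _ (by positivity) h2
    have h5 : 0 ≤ (2 * P + 1) * (1 / ((2 ^ m : ℕ) : ℝ)) := by positivity
    calc _ ≤ L * (1 / ((2 ^ m : ℕ) : ℝ)) + L * (1 / ((2 ^ m : ℕ) : ℝ)) := add_le_add h3 h4
      _ ≤ (2 * P + 2 * L + 1) * (1 / ((2 ^ m : ℕ) : ℝ)) := by linarith
      _ = _ := by ring

lemma IsCutoff.lpProj_re_trigPoly (hψ : IsCutoff ψ) (q : ℤ) (M : ℕ) (c : ℕ → ℂ) :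
    lpProj ψ q (fun x => (trigPoly M c x).re) =
      fun x => (trigPoly M (fun k => (dyadicSymbol ψ q (k : ℝ) : ℂ) * c k) x).re := by
  ext x
  rw [lpProj, fourierMultiplier_re_trigPoly]
  · simp
  · intro k
    rw [Complex.conj_ofReal]
    push_cast
    rw [hψ.dyadicSymbol_neg]

/-- Only two dyadic blocks survive, and each is again a bump at scale 2^m, to which the L^{p'} bound
applies. -/
lemma IsCutoff.exists_besovNorm_le (hψ : IsCutoff ψ) (s : ℝ) {p : ℝ≥0∞} (hp : 2 < p) :
    ∃ B : ℝ, 0 < B ∧ ∀ (m : ℕ) (A : ℝ) (c : ℕ → ℂ), IsBump (2 ^ m) A c →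
      besovNorm ψ s (ENNReal.conjExponent p) (fun x => (trigPoly (3 * 2 ^ m) c x).re) ≤
        ENNReal.ofReal (B * A * ((2 ^ m : ℕ) : ℝ) ^ s * ((2 ^ m : ℕ) : ℝ) ^ (p⁻¹).toReal) := by
  obtain ⟨B, hB, h⟩ := hψ.exists_isBump_dyadicSymbol_mul
  refine ⟨(1 + 2 ^ s) * 56 * B, by positivity, fun m A c hc => ?_⟩
  have hA := hc.nonneg
  set N : ℝ := ((2 ^ m : ℕ) : ℝ) with hN
  have hN0 : 0 < N := by positivity
  have hterm : ∀ q : ℕ, m ≤ q →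
      ENNReal.ofReal ((2 : ℝ) ^ ((((q + 1 : ℕ) : ℝ) - 1) * s)) *
        eLpNorm (lpProj ψ (((q + 1 : ℕ) : ℤ) - 1) (fun x => (trigPoly (3 * 2 ^ m) c x).re))
          (ENNReal.conjExponent p) volume ≤
      ENNReal.ofReal ((2 : ℝ) ^ ((q : ℝ) * s) * (56 * (B * A) * N ^ (p⁻¹).toReal)) := by
    intro q hq
    have e1 : (((q + 1 : ℕ) : ℝ) - 1) = q := by push_cast; ring
    have e2 : (((q + 1 : ℕ) : ℤ) - 1) = q := by push_cast; ring
    rw [e1, e2, hψ.lpProj_re_trigPoly, ENNReal.ofReal_mul (by positivity)]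
    gcongr
    exact eLpNorm_re_trigPoly_le hp (by positivity) (h m q hq A c hc)
  have hzero : ∀ n ∉ ({m + 1, m + 2} : Finset ℕ), ENNReal.ofReal ((2 : ℝ) ^ (((n : ℝ) - 1) * s)) *
      eLpNorm (lpProj ψ ((n : ℤ) - 1) (fun x => (trigPoly (3 * 2 ^ m) c x).re))
        (ENNReal.conjExponent p) volume = 0 := by
    intro n hn
    simp only [Finset.mem_insert, Finset.mem_singleton, not_or] at hn
    have : lpProj ψ ((n : ℤ) - 1) (fun x => (trigPoly (3 * 2 ^ m) c x).re) = 0 := by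
      rw [hψ.lpProj_re_trigPoly]
      ext x
      rw [trigPoly, Finset.sum_eq_zero]
      · rfl
      · intro k _
        by_cases hk : 2 ^ m < k ∧ k < 3 * 2 ^ m
        · rw [hψ.dyadicSymbol_eq_zero hk.1 hk.2 hn.1 hn.2]; simp
        · have : c k = 0 := by
            by_cases h1 : k ≤ 2 ^ m
            · exact hc.eq_zero_of_le k h1
            · exact hc.eq_zero_of_ge k (by omega)
          simp [this]
    rw [this, eLpNorm_zero, mul_zero]
  rw [besovNorm, tsum_eq_sum hzero, Finset.sum_pair (by omega)]
  refine (add_le_add (hterm m le_rfl) (hterm (m + 1) (by omega))).trans_eq ?_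
  rw [← ENNReal.ofReal_add (by positivity) (by positivity)]
  congr 1
  have e3 : (2 : ℝ) ^ ((m : ℝ) * s) = N ^ s := by
    rw [Real.rpow_mul (by norm_num), Real.rpow_natCast, hN]; push_cast; rfl
  have e4 : (2 : ℝ) ^ (((m + 1 : ℕ) : ℝ) * s) = N ^ s * 2 ^ s := by
    rw [← e3, ← Real.rpow_add (by norm_num)]; congr 1; push_cast; ring
  rw [e3, e4]; ring

end Besov

/-! ### The packet as a space-time test function. -/

lemma deriv_smoothTransition_eq_zero {x : ℝ} (hx : x ∉ Icc (0 : ℝ) 1) :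
    deriv Real.smoothTransition x = 0 := by
  rw [mem_Icc, not_and_or, not_le, not_le] at hx
  rcases hx with hx | hx
  · have : Real.smoothTransition =ᶠ[nhds x] fun _ => 0 := by
      filter_upwards [Iio_mem_nhds hx] with y hy
      exact Real.smoothTransition.zero_of_nonpos (le_of_lt hy)
    rw [this.deriv_eq]; simp
  · have : Real.smoothTransition =ᶠ[nhds x] fun _ => 1 := by
      filter_upwards [Ioi_mem_nhds hx] with y hy
      exact Real.smoothTransition.one_of_one_le (le_of_lt hy)
    rw [this.deriv_eq]; simp

lemma exists_abs_deriv_smoothTransition_le :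
    ∃ D : ℝ, 0 < D ∧ ∀ x, |deriv Real.smoothTransition x| ≤ D := by
  have hcont : Continuous (deriv Real.smoothTransition) :=
    (Real.smoothTransition.contDiff (n := 1)).continuous_deriv le_rfl
  obtain ⟨D, hD⟩ := isCompact_Icc.exists_bound_of_continuousOn (s := Icc (0 : ℝ) 1)
    hcont.continuousOn
  refine ⟨max D 1, by positivity, fun x => ?_⟩
  by_cases hx : x ∈ Icc (0 : ℝ) 1
  · exact (hD x hx).trans (le_max_left _ _)
  · rw [deriv_smoothTransition_eq_zero hx, abs_zero]; positivity

/-- The real wave packet `∑ₖ tent(k) cos(kx + (s - t) k^β)` at frequency scale `N`. -/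
def wave (β : ℝ) (N : ℕ) (t s : ℝ) (x : Torus) : ℝ := (trigPoly (3 * N) (waveCoeff β N t s) x).re

/-- The image of the wave packet under the dispersive operator. -/
def waveDeriv (β : ℝ) (N : ℕ) (t s : ℝ) (x : Torus) : ℝ :=
  (trigPoly (3 * N) (fun k => Complex.I * ((k : ℝ) ^ β : ℝ) * waveCoeff β N t s k) x).re

/-- A smooth cutoff in time: one for `s ≤ t - N^{-β}`, zero for `s ≥ t`. -/
def timeCutoff (β : ℝ) (N : ℕ) (t s : ℝ) : ℝ := Real.smoothTransition ((t - s) * (N : ℝ) ^ β)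

lemma re_trigPoly_const_mul (M : ℕ) (c : ℕ → ℂ) (a : ℝ) (x : Torus) :
    (trigPoly M (fun k => (a : ℂ) * c k) x).re = a * (trigPoly M c x).re := by
  rw [trigPoly, trigPoly, ← Complex.re_ofReal_mul, Finset.mul_sum]
  simp_rw [mul_assoc]

/-- The localised wave packet, as a space-time test function. -/
def packet (β : ℝ) (N : ℕ) (t : ℝ) : TestFunction where
  toFun s x := timeCutoff β N t s * wave β N t s x
  smooth := by
    have h1 : ContDiff ℝ ∞ fun z : ℝ × ℝ => timeCutoff β N t z.1 :=
      Real.smoothTransition.contDiff.comp (by fun_prop)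
    refine h1.mul ?_
    refine Complex.reCLM.contDiff.comp (?_ : ContDiff ℝ ∞ fun z : ℝ × ℝ =>
      trigPoly (3 * N) (waveCoeff β N t z.1) (z.2 : Torus))
    unfold trigPoly waveCoeff
    refine ContDiff.sum fun k _ => ?_
    simp_rw [fourier_coe_apply]
    have h2 : ContDiff ℝ ∞ fun z : ℝ × ℝ => (((z.1 - t) * (k : ℝ) ^ β : ℝ) : ℂ) :=
      Complex.ofRealCLM.contDiff.comp
        ((contDiff_fst.sub contDiff_const).mul contDiff_const)
    have h3 : ContDiff ℝ ∞ fun z : ℝ × ℝ => (z.2 : ℂ) :=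
      Complex.ofRealCLM.contDiff.comp contDiff_snd
    refine ContDiff.mul (ContDiff.mul (ContDiff.cexp (contDiff_const.mul h2)) contDiff_const)
      (ContDiff.cexp ?_)
    simp_rw [div_eq_mul_inv]
    exact (contDiff_const.mul h3).mul contDiff_const

lemma hasDerivAt_waveCoeff (β : ℝ) (N : ℕ) (t s : ℝ) (k : ℕ) :
    HasDerivAt (fun s => waveCoeff β N t s k)
      (Complex.I * ((k : ℝ) ^ β : ℝ) * waveCoeff β N t s k) s := by
  have h1 : HasDerivAt (fun s : ℝ => (((s - t) * (k : ℝ) ^ β : ℝ) : ℂ)) (((k : ℝ) ^ β : ℝ) : ℂ) s := by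
    have := (((hasDerivAt_id s).sub_const t).mul_const ((k : ℝ) ^ β)).ofReal_comp
    simpa using this
  have h2 := ((h1.const_mul Complex.I).cexp).mul_const (tent N k : ℂ)
  refine h2.congr_deriv ?_
  simp only [waveCoeff]; ring

lemma hasDerivAt_wave (β : ℝ) (N : ℕ) (t s : ℝ) (x : Torus) :
    HasDerivAt (fun s => wave β N t s x) (waveDeriv β N t s x) s := by
  have h1 : HasDerivAt (fun s => trigPoly (3 * N) (waveCoeff β N t s) x)
      (trigPoly (3 * N) (fun k => Complex.I * ((k : ℝ) ^ β : ℝ) * waveCoeff β N t s k) x) s := by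
    unfold trigPoly
    exact HasDerivAt.fun_sum fun k _ => (hasDerivAt_waveCoeff β N t s k).mul_const _
  exact Complex.reCLM.hasFDerivAt.comp_hasDerivAt s h1

lemma hasDerivAt_timeCutoff (β : ℝ) (N : ℕ) (t s : ℝ) :
    HasDerivAt (timeCutoff β N t)
      (deriv Real.smoothTransition ((t - s) * (N : ℝ) ^ β) * (-(N : ℝ) ^ β)) s := by
  have h1 : HasDerivAt (fun s : ℝ => (t - s) * (N : ℝ) ^ β) (-(N : ℝ) ^ β) s := by
    have := ((hasDerivAt_id s).const_sub t).mul_const ((N : ℝ) ^ β)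
    simpa using this
  have h2 : DifferentiableAt ℝ Real.smoothTransition ((t - s) * (N : ℝ) ^ β) :=
    (Real.smoothTransition.contDiff (n := 1)).differentiable one_ne_zero _
  exact h2.hasDerivAt.comp s h1

lemma packet_dt (β : ℝ) (N : ℕ) (t s : ℝ) (x : Torus) :
    (packet β N t).dt s x = deriv (timeCutoff β N t) s * wave β N t s x +
      timeCutoff β N t s * waveDeriv β N t s x := by
  rw [(hasDerivAt_timeCutoff β N t s).deriv]
  exact ((hasDerivAt_timeCutoff β N t s).mul (hasDerivAt_wave β N t s x)).deriv

lemma packet_toFun_eq (β : ℝ) (N : ℕ) (t s : ℝ) :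
    (packet β N t).toFun s = fun x => (trigPoly (3 * N)
      (fun k => (timeCutoff β N t s : ℂ) * waveCoeff β N t s k) x).re := by
  ext x
  rw [re_trigPoly_const_mul]; rfl

/-- The symbol k|k|^{2α-1} equals k^{2α} on nonnegative frequencies, including k = 0 because α > 0.
Thus the operator acts on the packet as ∂ₛ without the derivative of the cutoff. -/
lemma dispersive_packet {α : ℝ} (hα : 0 < α) (N : ℕ) (t s : ℝ) (x : Torus) :
    dispersive α ((packet (2 * α) N t).toFun s) x =
      timeCutoff (2 * α) N t s * waveDeriv (2 * α) N t s x := by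
  rw [packet_toFun_eq, dispersive, fourierMultiplier_re_trigPoly, waveDeriv,
    ← re_trigPoly_const_mul]
  · congr 3
    ext k
    have : (k : ℂ) * ((|((k : ℤ) : ℝ)| ^ (2 * α - 1) : ℝ) : ℂ) = (((k : ℝ) ^ (2 * α) : ℝ) : ℂ) := by
      rw [← Complex.ofReal_natCast, ← Complex.ofReal_mul]
      congr 1
      rw [Int.cast_natCast, abs_of_nonneg (by positivity)]
      rcases Nat.eq_zero_or_pos k with rfl | hk
      · simp [Real.zero_rpow (by positivity : 2 * α ≠ 0)]
      · have hk' : (0 : ℝ) < k := by exact_mod_cast hk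
        rw [Real.rpow_sub_one hk'.ne']; field_simp
    rw [← this]; push_cast; ring
  · intro k
    simp

/-! ### The duality estimate for weak solutions. -/

lemma continuous_re_trigPoly (M : ℕ) (c : ℕ → ℂ) : Continuous fun x => (trigPoly M c x).re :=
  Complex.continuous_re.comp (continuous_trigPoly _ _)

lemma abs_integral_mul_le {p : ℝ≥0∞} (hp : 1 ≤ p) {f g : Torus → ℝ}
    (hf : AEStronglyMeasurable f volume) (hg : AEStronglyMeasurable g volume) {a b : ℝ}
    (ha : 0 ≤ a) (hb : 0 ≤ b) (hfa : eLpNorm f p volume ≤ ENNReal.ofReal a)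
    (hgb : eLpNorm g (ENNReal.conjExponent p) volume ≤ ENNReal.ofReal b) :
    |∫ x, f x * g x| ≤ a * b := by
  have := ENNReal.HolderConjugate.conjExponent hp
  have h1 : ‖∫ x, f x * g x‖ₑ ≤ ENNReal.ofReal (a * b) := by
    calc _ ≤ ∫⁻ x, ‖f x * g x‖ₑ := enorm_integral_le_lintegral_enorm _
      _ = eLpNorm (f • g) 1 volume := by rw [eLpNorm_one_eq_lintegral_enorm]; rfl
      _ ≤ eLpNorm f p volume * eLpNorm g (ENNReal.conjExponent p) volume :=
        eLpNorm_smul_le_mul_eLpNorm hg hf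
      _ ≤ ENNReal.ofReal a * ENNReal.ofReal b := mul_le_mul' hfa hgb
      _ = _ := (ENNReal.ofReal_mul ha).symm
  rw [← ofReal_norm, ENNReal.ofReal_le_ofReal_iff (by positivity)] at h1
  exact h1

/-- The two indicators separate the short window where the cutoff varies from the whole lifetime of
the packet. Only the majorant has to be integrable, and `a` may be negative. -/
lemma abs_intervalIntegral_le {T a t c₁ c₂ : ℝ} {g : ℝ → ℝ} (hT : 0 ≤ T) (hat : a ≤ t) (ht : 0 ≤ t)
    (h₁ : 0 ≤ c₁) (h₂ : 0 ≤ c₂)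
    (hg : ∀ s ∈ Icc 0 T, |g s| ≤ (Icc a t).indicator (fun _ => c₁) s +
      (Icc 0 t).indicator (fun _ => c₂) s) :
    |∫ s in (0 : ℝ)..T, g s| ≤ c₁ * (t - a) + c₂ * t := by
  have hI : ∀ (a c : ℝ), Integrable ((Icc a t).indicator fun _ => c) := fun a c =>
    (integrable_indicator_iff measurableSet_Icc).2 (integrableOn_const (by simp))
  have hv : ∀ (a c : ℝ), a ≤ t → ∫ s, (Icc a t).indicator (fun _ => c) s = c * (t - a) := by
    intro a c hac
    rw [integral_indicator measurableSet_Icc, setIntegral_const, smul_eq_mul, mul_comm]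
    simp [hac]
  have hle : ∀ (a c s : ℝ), 0 ≤ c → 0 ≤ (Icc a t).indicator (fun _ => c) s := fun a c s hc =>
    indicator_nonneg (fun _ _ => hc) s
  rw [intervalIntegral.integral_of_le hT, ← Real.norm_eq_abs]
  calc _ ≤ ∫ s in Ioc 0 T, ((Icc a t).indicator (fun _ => c₁) s +
        (Icc 0 t).indicator (fun _ => c₂) s) := by
        refine norm_integral_le_of_norm_le ((hI a c₁).add (hI 0 c₂)).integrableOn ?_
        exact (ae_restrict_iff' measurableSet_Ioc).2
          (Filter.Eventually.of_forall fun s hs => hg s (Ioc_subset_Icc_self hs))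
    _ ≤ ∫ s, ((Icc a t).indicator (fun _ => c₁) s + (Icc 0 t).indicator (fun _ => c₂) s) :=
        setIntegral_le_integral ((hI a c₁).add (hI 0 c₂))
          (Filter.Eventually.of_forall fun s => add_nonneg (hle _ _ _ h₁) (hle _ _ _ h₂))
    _ = _ := by rw [integral_add (hI a c₁) (hI 0 c₂), hv a c₁ hat, hv 0 c₂ ht, sub_zero]

/-- If a weak solution is bounded in `L^p` up to time `t = K N^{-β}`, then its initial datum pairs
with the dispersed wave packet as with a concentrated one, up to lower-order errors. -/
lemma exists_abs_integral_mul_wave_le {ψ : ℝ → ℝ} (hψ : IsCutoff ψ) {α : ℝ} (hα₀ : 0 < α)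
    (hα₁ : α < 1 / 2) {p : ℝ≥0∞} (hp : 2 < p) {δ : ℝ} (hδ : 0 < δ) :
    ∃ B : ℝ, 0 < B ∧ ∀ (T : ℝ), 0 < T → ∀ (E : ModelEquation) (f₀ : Torus → ℝ) (f : ℝ → L1),
      E.IsWeakSolution α T f₀ f → ∀ (M C : ℝ) (F : ℝ≥0) (m : ℕ) (t K : ℝ), 0 ≤ M → 0 ≤ C →
      0 < t → t ≤ T → 1 ≤ K → t * ((2 ^ m : ℕ) : ℝ) ^ (2 * α) = K →
      (∀ s ∈ Icc 0 t, eLpNorm (f s) p volume ≤ ENNReal.ofReal M) →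
      (∀ s ∈ Icc 0 t, eLpNorm (fun x => f s x - E.bar f s x) p volume ≤
        ENNReal.ofReal (C * s ^ δ)) →
      (∀ s ∈ Icc 0 T, ∀ φ : smoothTorus,
        ‖E.forcing s φ‖ₑ ≤ F * besovNorm ψ (2 * α - δ) (ENNReal.conjExponent p) φ) →
      |∫ x, f₀ x * wave (2 * α) (2 ^ m) t 0 x| ≤
        B * ((2 ^ m : ℕ) : ℝ) ^ (p⁻¹).toReal *
          (M + C * (K ^ 2 * t ^ δ) + F * (K ^ 2 * ((2 ^ m : ℕ) : ℝ) ^ (-δ))) := by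
  obtain ⟨D, hD0, hD⟩ := exists_abs_deriv_smoothTransition_le
  obtain ⟨B, hB0, hB⟩ := hψ.exists_besovNorm_le (2 * α - δ) hp
  -- The L^{p'} constant 56 is multiplied by the bump size: 2 in the cutoff window, and 6·2K after
  -- applying 𝓛_α. The forcing term carries the bump size 2K.
  refine ⟨112 * D + 672 + 2 * B, by positivity,
    fun T hT E f₀ f hf M C F m t K hM hC ht htT hK htK hfM hfC hF => ?_⟩
  have hp1 : 1 ≤ p := one_le_two.trans hp.le
  set β : ℝ := 2 * α with hβ
  have hβ0 : 0 < β := by positivity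
  have hβ1 : β < 1 := by linarith
  set N : ℕ := 2 ^ m with hNdef
  have hN : 0 < N := by positivity
  set R : ℝ := (N : ℝ) with hR
  have hR0 : 0 < R := by rw [hR]; exact_mod_cast hN
  set e := (p⁻¹).toReal with he
  have hwf := hf.weak_formulation (packet β N t)
  have hcutT : timeCutoff β N t T = 0 :=
    Real.smoothTransition.zero_of_nonpos (mul_nonpos_of_nonpos_of_nonneg (by linarith) (by positivity))
  have hcut0 : timeCutoff β N t 0 = 1 :=
    Real.smoothTransition.one_of_one_le (by rw [sub_zero]; exact htK ▸ hK)
  have hcut : ∀ s, |timeCutoff β N t s| ≤ 1 := fun s => by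
    rw [timeCutoff, abs_of_nonneg (Real.smoothTransition.nonneg _)]; exact Real.smoothTransition.le_one _
  have hcutz : ∀ s, t ≤ s → timeCutoff β N t s = 0 := fun s hs =>
    Real.smoothTransition.zero_of_nonpos (mul_nonpos_of_nonpos_of_nonneg (by linarith) (by positivity))
  have hfT : ∫ x, f T x * (packet β N t).toFun T x = 0 := by
    simp [packet, hcutT]
  have hf0 : ∫ x, f₀ x * (packet β N t).toFun 0 x = ∫ x, f₀ x * wave β N t 0 x := by
    simp [packet, hcut0]
  rw [hfT, hf0, zero_sub] at hwf
  have hbumpK : ∀ s ∈ Icc 0 t, IsBump N (2 * K) (waveCoeff β N t s) := fun s hs =>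
    isBump_waveCoeff hβ0 hβ1 hN hK (by
      rw [abs_of_nonpos (by linarith [hs.2]), ← htK]
      gcongr; linarith [hs.1])
  have hcw : ∀ s, Continuous (wave β N t s) := fun s => continuous_re_trigPoly _ _
  have hcd : ∀ s, Continuous (waveDeriv β N t s) := fun s => continuous_re_trigPoly _ _
  have hint : ∀ (u : L1) (w : Torus → ℝ), Continuous w → Integrable fun x => u x * w x := by
    intro u w hw
    obtain ⟨b, hb⟩ := isCompact_univ.exists_bound_of_continuousOn hw.continuousOn
    exact (L1.integrable_coeFn u).mul_bdd (c := b) hw.aestronglyMeasurable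
      (Filter.Eventually.of_forall fun x => hb x (mem_univ x))
  -- The terms with ∂ₛw combine into (f - f̄)𝓛_α w, because w solves the free equation; what is left
  -- is f against the derivative of the cutoff.
  have hg : ∀ s ∈ Icc 0 T, |∫ x, (f s x * (packet β N t).dt s x -
      E.bar f s x * dispersive α ((packet β N t).toFun s) x)| ≤
      (Icc (t - 1 / R ^ β) t).indicator (fun _ => D * R ^ β * (M * (112 * R ^ e))) s +
      (Icc 0 t).indicator (fun _ => C * t ^ δ * (672 * K * R ^ β * R ^ e)) s := by
    intro s hs
    have e1 : ∫ x, (f s x * (packet β N t).dt s x -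
        E.bar f s x * dispersive α ((packet β N t).toFun s) x) =
        deriv (timeCutoff β N t) s * (∫ x, f s x * wave β N t s x) +
        timeCutoff β N t s * ∫ x, (f s x - E.bar f s x) * waveDeriv β N t s x := by
      rw [← integral_const_mul, ← integral_const_mul, ← integral_add]
      · refine integral_congr_ae (Filter.Eventually.of_forall fun x => ?_)
        simp only [packet_dt]
        rw [dispersive_packet hα₀]; ring
      · exact (hint _ _ (hcw s)).const_mul _
      · refine Integrable.const_mul ?_ _
        simp_rw [sub_mul]
        exact (hint _ _ (hcd s)).sub (hint _ _ (hcd s))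
    rw [e1]
    refine (abs_add_le _ _).trans (add_le_add ?_ ?_)
    · rw [abs_mul, (hasDerivAt_timeCutoff β N t s).deriv, abs_mul, abs_neg,
        abs_of_nonneg (by positivity : 0 ≤ (N : ℝ) ^ β)]
      by_cases hmem : (t - s) * (N : ℝ) ^ β ∈ Icc (0 : ℝ) 1
      · have hRβ : 0 < R ^ β := by positivity
        have hs1 : s ≤ t := by
          have := nonneg_of_mul_nonneg_left hmem.1 hRβ
          linarith
        have hs2 : t - 1 / R ^ β ≤ s := by
          have := (le_div_iff₀ hRβ).2 hmem.2
          linarith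
        rw [indicator_of_mem (show s ∈ Icc (t - 1 / R ^ β) t from ⟨hs2, hs1⟩)]
        -- In the window |s - t| ≤ N^{-β} the bump constant is 2 rather than 2K, so the main term M
        -- loses no power of K.
        have hb : IsBump N 2 (waveCoeff β N t s) := by
          have := isBump_waveCoeff hβ0 hβ1 hN (t := t) (s := s) le_rfl
            (by rw [abs_of_nonpos (by linarith), neg_sub]; exact hmem.2)
          simpa using this
        refine mul_le_mul ?_ ?_ (abs_nonneg _) (by positivity)
        · gcongr
          exact hD _
        · refine abs_integral_mul_le hp1 (Lp.aestronglyMeasurable _) (hcw s).aestronglyMeasurable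
            hM (by positivity) (hfM s ⟨hs.1, hs1⟩)
            ((eLpNorm_re_trigPoly_le hp hN hb).trans_eq ?_)
          norm_num [hR, he]
      · rw [deriv_smoothTransition_eq_zero hmem, abs_zero, zero_mul, zero_mul]
        exact indicator_nonneg (fun _ _ => by positivity) s
    · rcases le_or_gt s t with hst | hst
      · rw [indicator_of_mem (show s ∈ Icc 0 t from ⟨hs.1, hst⟩), abs_mul]
        have hsδ : s ^ δ ≤ t ^ δ := Real.rpow_le_rpow hs.1 hst hδ.le
        have h1 := abs_integral_mul_le (f := fun x => f s x - E.bar f s x) hp1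
          ((Lp.aestronglyMeasurable _).sub (Lp.aestronglyMeasurable _))
          (hcd s).aestronglyMeasurable (a := C * t ^ δ) (b := 672 * K * R ^ β * R ^ e)
          (by positivity) (by positivity)
          ((hfC s ⟨hs.1, hst⟩).trans (ENNReal.ofReal_le_ofReal (by gcongr)))
          ((eLpNorm_re_trigPoly_le hp hN ((hbumpK s ⟨hs.1, hst⟩).mul_frequency hβ0 hβ1 hN)).trans
            (ENNReal.ofReal_le_ofReal (le_of_eq (by rw [← hR, ← he]; ring))))
        exact (mul_le_of_le_one_left (abs_nonneg _) (hcut s)).trans h1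
      · rw [hcutz s hst.le, zero_mul, abs_zero]
        exact indicator_nonneg (fun _ _ => by positivity) s
  have hFs : ∀ s ∈ Icc 0 T, |E.forcing s ((packet β N t).slice s)| ≤
      (Icc 0 t).indicator (fun _ => 0) s +
      (Icc 0 t).indicator (fun _ => F * (B * (2 * K) * R ^ (β - δ) * R ^ e)) s := by
    intro s hs
    have h1 := hF s hs ((packet β N t).slice s)
    rw [indicator_zero, zero_add]
    have h2 : ((packet β N t).slice s : Torus → ℝ) = (packet β N t).toFun s := rfl
    rw [h2] at h1
    rcases le_or_gt s t with hst | hst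
    · rw [indicator_of_mem (show s ∈ Icc 0 t from ⟨hs.1, hst⟩)]
      rw [packet_toFun_eq] at h1
      have h3 := hB m (2 * K) _ ((hbumpK s ⟨hs.1, hst⟩).const_mul
        (a := (timeCutoff β N t s : ℂ)) (by rw [Complex.norm_real]; exact hcut s))
      have h4 := h1.trans (mul_le_mul_right h3 (F : ℝ≥0∞))
      rw [← ofReal_norm, ← ENNReal.ofReal_coe_nnreal, ← ENNReal.ofReal_mul F.coe_nonneg,
        ENNReal.ofReal_le_ofReal_iff (by positivity)] at h4
      exact h4
    · have : (packet β N t).slice s = 0 := by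
        ext x
        change timeCutoff β N t s * wave β N t s x = 0
        rw [hcutz s hst.le, zero_mul]
      rw [this, map_zero, abs_zero]
      exact indicator_nonneg (fun _ _ => by positivity) s
  have hi1 := abs_intervalIntegral_le hT.le
    (sub_le_self t (by positivity : 0 ≤ 1 / R ^ β)) ht.le (by positivity) (by positivity) hg
  have hi2 := abs_intervalIntegral_le hT.le ht.le ht.le le_rfl (by positivity) hFs
  have habs : |∫ x, f₀ x * wave β N t 0 x| ≤
      (D * R ^ β * (M * (112 * R ^ e)) * (t - (t - 1 / R ^ β)) +
        C * t ^ δ * (672 * K * R ^ β * R ^ e) * t) +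
      (0 * (t - 0) + F * (B * (2 * K) * R ^ (β - δ) * R ^ e) * t) := by
    rw [← abs_neg, hwf]
    exact (abs_add_le _ _).trans (add_le_add hi1 hi2)
  refine habs.trans ?_
  have hRβ : 0 < R ^ β := by positivity
  have ht' : t = K / R ^ β := by rw [eq_div_iff hRβ.ne']; exact htK
  -- Integrating over a time t turns N^β into K. Together with the K in the bump constant this gives
  -- the K² of both error terms.
  have e2 : R ^ (β - δ) * t = K * R ^ (-δ) := by
    rw [ht', sub_eq_add_neg, Real.rpow_add hR0]; field_simp
  have e3 : R ^ β * t = K := by rw [mul_comm]; exact htK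
  have e4 : D * R ^ β * (M * (112 * R ^ e)) * (t - (t - 1 / R ^ β)) = 112 * D * (R ^ e * M) := by
    field_simp; ring
  have e5 : C * t ^ δ * (672 * K * R ^ β * R ^ e) * t = 672 * (R ^ e * (C * (K ^ 2 * t ^ δ))) := by
    calc _ = C * t ^ δ * (672 * K * R ^ e) * (R ^ β * t) := by ring
      _ = _ := by rw [e3]; ring
  have e6 : F * (B * (2 * K) * R ^ (β - δ) * R ^ e) * t =
      2 * B * (R ^ e * (F * (K ^ 2 * R ^ (-δ)))) := by
    calc _ = F * (B * (2 * K) * R ^ e) * (R ^ (β - δ) * t) := by ring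
      _ = _ := by rw [e2]; ring
  rw [e4, e5, e6, zero_mul, zero_add]
  have n1 : 0 ≤ R ^ e * M := by positivity
  have n2 : 0 ≤ R ^ e * (C * (K ^ 2 * t ^ δ)) := by positivity
  have n3 : 0 ≤ R ^ e * (F * (K ^ 2 * R ^ (-δ))) := by positivity
  calc _ ≤ (112 * D + 672 + 2 * B) * (R ^ e * M) +
        (112 * D + 672 + 2 * B) * (R ^ e * (C * (K ^ 2 * t ^ δ))) +
        (112 * D + 672 + 2 * B) * (R ^ e * (F * (K ^ 2 * R ^ (-δ)))) := by
        rw [add_assoc]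
        refine add_le_add ?_ (add_le_add ?_ ?_) |>.trans_eq (add_assoc _ _ _).symm
        · exact mul_le_mul_of_nonneg_right (by linarith) n1
        · exact mul_le_mul_of_nonneg_right (by linarith) n2
        · exact mul_le_mul_of_nonneg_right (by linarith) n3
    _ = _ := by ring

/-! ### The dispersed packet: L² norm, uniform bound and interpolation. -/

/-- Without a constant term, P² has only positive frequencies and integrates to zero, so the real
part carries exactly half of the L² mass of P. -/
lemma integral_re_trigPoly_sq (M : ℕ) (c : ℕ → ℂ) (h0 : c 0 = 0) :
    ∫ x, (trigPoly M c x).re ^ 2 = Real.pi * ∑ k ∈ Finset.range M, ‖c k‖ ^ 2 := by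
  have hci : ∀ {F : Type} [NormedAddCommGroup F] {g : Torus → F}, Continuous g → Integrable g :=
    fun hg => Continuous.integrable_of_hasCompactSupport hg (HasCompactSupport.of_compactSpace _)
  have hsq : ∫ x, trigPoly M c x ^ 2 = 0 := by
    have h1 : ∀ x, trigPoly M c x ^ 2 = ∑ j ∈ Finset.range M, ∑ k ∈ Finset.range M, (c j * c k) *
        (fourier (j : ℤ) x * (starRingEnd ℂ) (fourier (-(k : ℤ)) x)) := by
      intro x
      rw [sq, trigPoly, Finset.sum_mul_sum]
      refine Finset.sum_congr rfl fun j _ => Finset.sum_congr rfl fun k _ => ?_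
      rw [fourier_neg, Complex.conj_conj]; ring
    have hint : ∀ j k : ℕ, Integrable (fun x : Torus => (c j * c k) *
        (fourier (j : ℤ) x * (starRingEnd ℂ) (fourier (-(k : ℤ)) x))) := fun j k => by
      have : Continuous (fun x : Torus => (starRingEnd ℂ) (fourier (-(k : ℤ)) x)) :=
        Complex.continuous_conj.comp (fourier (-(k : ℤ))).continuous
      exact hci (by fun_prop)
    simp_rw [h1]
    rw [integral_finsetSum _ fun j _ => integrable_finsetSum _ fun k _ => hint j k]
    refine Finset.sum_eq_zero fun j _ => ?_
    rw [integral_finsetSum _ fun k _ => hint j k]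
    refine Finset.sum_eq_zero fun k _ => ?_
    rw [integral_const_mul, integral_fourier_mul_conj]
    split_ifs with h
    · have : k = 0 := by omega
      rw [this, h0]; simp
    · rw [mul_zero]
  have hc := continuous_trigPoly M c
  have h2 : ∀ x, (trigPoly M c x).re ^ 2 =
      (1 / 2) * ‖trigPoly M c x‖ ^ 2 + (1 / 2) * (trigPoly M c x ^ 2).re := by
    intro x
    rw [Complex.sq_norm, Complex.normSq_apply, sq (trigPoly M c x), Complex.mul_re]; ring
  simp_rw [h2]
  have hre : Continuous fun x => (trigPoly M c x ^ 2).re := Complex.continuous_re.comp (hc.pow 2)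
  rw [integral_add (hci (by fun_prop)) (hci (by fun_prop)), integral_const_mul, integral_const_mul,
    integral_norm_sq_trigPoly]
  have h3 : ∫ x, (trigPoly M c x ^ 2).re = 0 := by
    have := integral_re (𝕜 := ℂ) (f := fun x => trigPoly M c x ^ 2) (hci (hc.pow 2))
    rw [hsq] at this
    simpa using this
  rw [h3]; ring

/-- Twice the even part of the wave packet at time zero. -/
def evenWave (β : ℝ) (N : ℕ) (t : ℝ) (x : Torus) : ℝ := wave β N t 0 x + wave β N t 0 (-x)

lemma continuous_wave (β : ℝ) (N : ℕ) (t s : ℝ) : Continuous (wave β N t s) :=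
  continuous_re_trigPoly _ _

lemma continuous_evenWave (β : ℝ) (N : ℕ) (t : ℝ) : Continuous (evenWave β N t) :=
  (continuous_wave β N t 0).add ((continuous_wave β N t 0).comp continuous_neg)

lemma evenWave_eq (β : ℝ) (N : ℕ) (t : ℝ) (x : Torus) :
    evenWave β N t x = (trigPoly (3 * N)
      (fun k => ((2 * Real.cos (t * (k : ℝ) ^ β) * tent N k : ℝ) : ℂ)) x).re := by
  rw [evenWave, wave, wave, trigPoly, trigPoly, trigPoly, ← Complex.add_re,
    ← Finset.sum_add_distrib, Complex.re_sum, Complex.re_sum]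
  refine Finset.sum_congr rfl fun k _ => ?_
  have h1 : (fourier (k : ℤ) (-x) : ℂ) = (starRingEnd ℂ) (fourier (k : ℤ) x) := by
    rw [← fourier_neg, fourier_apply, fourier_apply, smul_neg, neg_smul]
  have h2 : (waveCoeff β N t 0 k).re = Real.cos (t * (k : ℝ) ^ β) * tent N k := by
    rw [waveCoeff, Complex.re_mul_ofReal, mul_comm Complex.I, Complex.exp_ofReal_mul_I_re,
      zero_sub, neg_mul, Real.cos_neg]
  rw [h1, Complex.re_ofReal_mul, Complex.add_re, Complex.mul_re, Complex.mul_re, h2,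
    Complex.conj_re, Complex.conj_im]
  ring

/-- The tent is at least 1/2 on [2N, 5N/2], which contains at least N/2 integers. -/
lemma div_eight_le_sum_tent_sq {N : ℕ} (hN : 0 < N) :
    (N : ℝ) / 8 ≤ ∑ k ∈ Finset.range (3 * N), tent N k ^ 2 := by
  have hN' : (0 : ℝ) < N := by exact_mod_cast hN
  calc (N : ℝ) / 8 ≤ ∑ k ∈ Finset.Icc (2 * N) (2 * N + N / 2), (1 / 4 : ℝ) := by
        rw [Finset.sum_const, Nat.card_Icc, nsmul_eq_mul]
        have h1 : N ≤ 2 * (2 * N + N / 2 + 1 - 2 * N) := by omega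
        have h2 : (N : ℝ) ≤ 2 * ((2 * N + N / 2 + 1 - 2 * N : ℕ) : ℝ) := by exact_mod_cast h1
        linarith
    _ ≤ ∑ k ∈ Finset.Icc (2 * N) (2 * N + N / 2), tent N k ^ 2 := by
        refine Finset.sum_le_sum fun k hk => ?_
        rw [Finset.mem_Icc] at hk
        have h1 : (2 : ℝ) * N ≤ k := by exact_mod_cast hk.1
        have h2 : 2 * (k : ℝ) ≤ 5 * N := by exact_mod_cast (by omega : 2 * k ≤ 5 * N)
        have h3 : 1 / 2 ≤ tent N k := by
          refine le_max_of_le_right ?_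
          rw [abs_of_nonneg (by linarith), le_sub_comm, div_le_iff₀ hN']
          linarith
        nlinarith
    _ ≤ _ := by
        refine Finset.sum_le_sum_of_subset_of_nonneg (fun k hk => ?_) fun k _ _ => sq_nonneg _
        rw [Finset.mem_Icc] at hk
        rw [Finset.mem_range]; omega

/-- At the dispersed time, the even wave packet keeps its `L²` norm but is small uniformly. -/
lemma exists_evenWave_bounds {β : ℝ} (hβ : 0 < β) (hβ' : β < 1) :
    ∃ C : ℝ, 0 < C ∧ ∀ (N J : ℕ) (t : ℝ), 0 < J → t * (N : ℝ) ^ β = (J : ℝ) ^ 8 → 2 * J ^ 8 ≤ N →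
      (∀ x, |evenWave β N t x| ≤ C * N / J) ∧
      (C ≤ J → (N : ℝ) / 4 ≤ ∫ x, evenWave β N t x ^ 2) := by
  obtain ⟨C, hC, h⟩ := exists_norm_expSum_le hβ hβ'
  -- The uniform bound needs only 2C; with 32C, the condition 32C ≤ J makes the oscillating part of
  -- the L² sum at most N/16.
  refine ⟨32 * C, by positivity, fun N J t hJ ht hJN => ?_⟩
  have hJ1 : 1 ≤ J ^ 8 := Nat.one_le_pow _ _ hJ
  have hN : 0 < N := by omega
  have hN' : (0 : ℝ) < N := by exact_mod_cast hN
  have hJ' : (0 : ℝ) < J := by exact_mod_cast hJ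
  have hJ8 : (0 : ℝ) < (J : ℝ) ^ 8 := by positivity
  constructor
  · have hw : ∀ x, |wave β N t 0 x| ≤ C * N / J := by
      intro x
      induction x using QuotientAddGroup.induction_on with
      | H y =>
        refine (Complex.abs_re_le_norm _).trans ?_
        have h1 := h N J t hJ ht.ge (by linarith) hJN 1 _ (isBump_tent hN) y
        rw [mul_one] at h1
        refine le_of_eq_of_le ?_ h1
        congr 1
        rw [trigPoly]
        refine Finset.sum_congr rfl fun k _ => ?_
        have h2 : (fourier (k : ℤ) ((y : ℝ) : Torus) : ℂ) = Complex.exp (Complex.I * (k * y : ℝ)) := by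
          rw [fourier_coe_apply]
          congr 1
          push_cast
          have : (Real.pi : ℂ) ≠ 0 := by exact_mod_cast Real.pi_ne_zero
          field_simp
        rw [h2, waveCoeff, mul_right_comm, mul_comm, ← Complex.exp_add]
        congr 2
        push_cast; ring
    intro x
    refine (abs_add_le _ _).trans ((add_le_add (hw x) (hw (-x))).trans ?_)
    have : 0 ≤ C * N / J := by positivity
    calc _ ≤ 32 * (C * N / J) := by linarith
      _ = _ := by ring
  · intro hCJ
    simp_rw [evenWave_eq]
    rw [integral_re_trigPoly_sq _ _ (by simp [show tent N 0 = 0 by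
      have := (isBump_tent hN).eq_zero_of_le 0 (Nat.zero_le _); exact_mod_cast this])]
    have hsq : IsBump N 2 (fun k => ((tent N k ^ 2 : ℝ) : ℂ)) := by
      have h1 := (isBump_tent hN).mul (B := 1) (m := fun k => (tent N k : ℂ))
        (fun k _ _ => (isBump_tent hN).norm_le k) (fun k _ _ => (isBump_tent hN).norm_sub_le k)
      simpa [sq] using h1
    -- By 4cos² = 2 + 2cos 2·, the L² sum is a main term plus an exponential sum at x = 0 and time
    -- 2t. This is why the exponential sum test allows tN^β up to 2J^8.
    have h1 := h N J (2 * t) hJ (by nlinarith) (by nlinarith) hJN 2 _ hsq 0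
    set S := ∑ k ∈ Finset.range (3 * N), ((tent N k ^ 2 : ℝ) : ℂ) *
      Complex.exp (Complex.I * ((k : ℝ) * 0 - 2 * t * (k : ℝ) ^ β : ℝ)) with hS
    have h2 : ∑ k ∈ Finset.range (3 * N),
        ‖((2 * Real.cos (t * (k : ℝ) ^ β) * tent N k : ℝ) : ℂ)‖ ^ 2 =
        2 * (∑ k ∈ Finset.range (3 * N), tent N k ^ 2) + 2 * S.re := by
      rw [hS, Complex.re_sum, Finset.mul_sum, Finset.mul_sum, ← Finset.sum_add_distrib]
      refine Finset.sum_congr rfl fun k _ => ?_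
      rw [Complex.norm_real, Real.norm_eq_abs, sq_abs, Complex.re_ofReal_mul, mul_comm Complex.I,
        Complex.exp_ofReal_mul_I_re, mul_zero, zero_sub, Real.cos_neg, mul_assoc 2 t, Real.cos_two_mul]
      ring
    have h3 : -(C * 2 * N / J) ≤ S.re := by
      have := (abs_le.1 (Complex.abs_re_le_norm S)).1
      linarith
    have h4 : C * 2 * N / J ≤ N / 16 := by
      rw [div_le_div_iff₀ hJ' (by norm_num)]
      nlinarith
    have h5 := div_eight_le_sum_tent_sq hN
    rw [h2]
    have h6 : (N : ℝ) / 8 ≤ 2 * (∑ k ∈ Finset.range (3 * N), tent N k ^ 2) + 2 * S.re := by linarith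
    calc (N : ℝ) / 4 = 2 * (N / 8) := by ring
      _ ≤ Real.pi * (N / 8) := by gcongr; exact Real.two_le_pi
      _ ≤ _ := by gcongr

/-- Interpolation of the `L^p` norm between `L²` and a uniform bound. -/
lemma eLpNorm_le_of_abs_le {p : ℝ≥0∞} (hp : 2 < p) {g : Torus → ℝ} (hg : Continuous g) {H : ℝ}
    (hH : 0 < H) (hgH : ∀ x, |g x| ≤ H) :
    eLpNorm g p volume ≤
      ENNReal.ofReal (H ^ (1 - 2 * (p⁻¹).toReal) * (∫ x, g x ^ 2) ^ (p⁻¹).toReal) := by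
  have hQ : 0 ≤ ∫ x, g x ^ 2 := integral_nonneg fun x => sq_nonneg _
  rcases eq_or_ne p ⊤ with rfl | hpt
  · simp only [ENNReal.inv_top, ENNReal.toReal_zero, mul_zero, sub_zero, Real.rpow_one,
      Real.rpow_zero, mul_one]
    rw [eLpNorm_exponent_top]
    refine eLpNormEssSup_le_of_ae_bound (Filter.Eventually.of_forall fun x => hgH x)
  · have hp0 : p ≠ 0 := (zero_lt_two.trans hp).ne'
    set r := p.toReal with hr
    have hr2 : 2 < r := by
      have := ENNReal.toReal_strict_mono hpt hp
      simpa using this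
    have hr0 : 0 < r := by linarith
    rw [eLpNorm_eq_lintegral_rpow_enorm_toReal hp0 hpt, ENNReal.toReal_inv, ← hr, one_div]
    have h1 : ∫⁻ x, ‖g x‖ₑ ^ r ≤ ENNReal.ofReal (H ^ (r - 2) * ∫ x, g x ^ 2) := by
      rw [← integral_const_mul, ofReal_integral_eq_lintegral_ofReal]
      · refine lintegral_mono fun x => ?_
        rw [← ofReal_norm, ENNReal.ofReal_rpow_of_nonneg (norm_nonneg _) hr0.le]
        refine ENNReal.ofReal_le_ofReal ?_
        rw [Real.norm_eq_abs]
        rcases (abs_nonneg (g x)).eq_or_lt with h0 | h0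
        · rw [← h0, Real.zero_rpow hr0.ne']; positivity
        · calc |g x| ^ r = |g x| ^ (r - 2) * |g x| ^ (2 : ℝ) := by
                rw [← Real.rpow_add h0]; congr 1; ring
            _ = |g x| ^ (r - 2) * g x ^ 2 := by rw [Real.rpow_two, sq_abs]
            _ ≤ _ := mul_le_mul_of_nonneg_right
                (Real.rpow_le_rpow h0.le (hgH x) (by linarith)) (sq_nonneg _)
      · exact Continuous.integrable_of_hasCompactSupport (by fun_prop)
          (HasCompactSupport.of_compactSpace _)
      · exact Filter.Eventually.of_forall fun x => by positivity
    calc _ ≤ ENNReal.ofReal (H ^ (r - 2) * ∫ x, g x ^ 2) ^ r⁻¹ := by gcongr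
      _ = ENNReal.ofReal ((H ^ (r - 2) * ∫ x, g x ^ 2) ^ r⁻¹) :=
        ENNReal.ofReal_rpow_of_nonneg (by positivity) (by positivity)
      _ = _ := by
        rw [Real.mul_rpow (by positivity) hQ, ← Real.rpow_mul hH.le]
        congr 3
        field_simp

/-! ### Choice of scales and the uniform boundedness argument. -/

/-- For fixed J take t = J^8 N^{-β}; as N = 2^m grows, t and both error factors tend to zero. The
bound t ≤ 1/J makes these times tend to zero along the sequence. The condition 0 < J stands inside
the existential so that `choose` yields total sequences. -/
lemma exists_scale {β δ : ℝ} (hβ : 0 < β) (hδ : 0 < δ) (J : ℕ) :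
    ∃ (m : ℕ) (t : ℝ), 0 < J → 2 * J ^ 8 ≤ 2 ^ m ∧ 0 < t ∧ t * ((2 ^ m : ℕ) : ℝ) ^ β = (J : ℝ) ^ 8 ∧
      t ≤ 1 / J ∧ ((J : ℝ) ^ 8) ^ 2 * t ^ δ ≤ 1 ∧
      ((J : ℝ) ^ 8) ^ 2 * ((2 ^ m : ℕ) : ℝ) ^ (-δ) ≤ 1 := by
  rcases Nat.eq_zero_or_pos J with rfl | hJ
  · exact ⟨0, 0, fun h => absurd h (lt_irrefl 0)⟩
  have hJ' : (0 : ℝ) < J := by exact_mod_cast hJ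
  have hN : Filter.Tendsto (fun m : ℕ => ((2 ^ m : ℕ) : ℝ)) Filter.atTop Filter.atTop :=
    tendsto_natCast_atTop_atTop.comp (tendsto_pow_atTop_atTop_of_one_lt one_lt_two)
  have ht : Filter.Tendsto (fun m : ℕ => (J : ℝ) ^ 8 * ((2 ^ m : ℕ) : ℝ) ^ (-β)) Filter.atTop
      (nhds 0) := by
    simpa using ((tendsto_rpow_neg_atTop hβ).comp hN).const_mul ((J : ℝ) ^ 8)
  have htδ : Filter.Tendsto (fun m : ℕ => ((J : ℝ) ^ 8) ^ 2 *
      ((J : ℝ) ^ 8 * ((2 ^ m : ℕ) : ℝ) ^ (-β)) ^ δ) Filter.atTop (nhds 0) := by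
    have := (ht.rpow_const (Or.inr hδ.le)).const_mul (((J : ℝ) ^ 8) ^ 2)
    simpa [Real.zero_rpow hδ.ne'] using this
  have hNδ : Filter.Tendsto (fun m : ℕ => ((J : ℝ) ^ 8) ^ 2 * ((2 ^ m : ℕ) : ℝ) ^ (-δ)) Filter.atTop
      (nhds 0) := by
    simpa using ((tendsto_rpow_neg_atTop hδ).comp hN).const_mul (((J : ℝ) ^ 8) ^ 2)
  obtain ⟨m, h1, h2, h3, h4⟩ := ((hN.eventually_ge_atTop ((2 * J ^ 8 : ℕ) : ℝ)).and
    ((ht.eventually_le_const (by positivity : (0 : ℝ) < 1 / J)).and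
    ((htδ.eventually_le_const one_pos).and (hNδ.eventually_le_const one_pos)))).exists
  refine ⟨m, (J : ℝ) ^ 8 * ((2 ^ m : ℕ) : ℝ) ^ (-β), fun _ => ⟨by exact_mod_cast h1, ?_, ?_, h2, h3, h4⟩⟩
  · positivity
  · rw [mul_assoc, ← Real.rpow_add (by positivity)]; simp

/-- Reflection x ↦ -x moves the symmetrisation from the datum to the packet. -/
lemma integral_evenSum_mul {p : ℝ≥0∞} (hp : 1 ≤ p) {g w : Torus → ℝ} (hg : MemLp g p volume)
    (hw : Continuous w) :
    ∫ x, (g x + g (-x)) * w x = ∫ x, g x * (w x + w (-x)) := by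
  have hneg : MemLp (fun x => g (-x)) p volume :=
    hg.comp_measurePreserving (Measure.measurePreserving_neg volume)
  have hint : ∀ {u v : Torus → ℝ}, MemLp u p volume → Continuous v →
      Integrable fun x => u x * v x := by
    intro u v hu hv
    obtain ⟨b, hb⟩ := isCompact_univ.exists_bound_of_continuousOn hv.continuousOn
    exact (hu.integrable hp).mul_bdd (c := b) hv.aestronglyMeasurable
      (Filter.Eventually.of_forall fun x => hb x (mem_univ x))
  simp_rw [add_mul, mul_add]
  rw [integral_add (hint hg hw) (hint hneg hw),
    integral_add (hint hg hw) (hint (v := fun x => w (-x)) hg (hw.comp continuous_neg))]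
  congr 1
  rw [← integral_neg_eq_self (fun x => g (-x) * w x)]
  simp

/-- By the uniform boundedness principle, a family of continuous functions whose duals in `L^p`
are not uniformly bounded has an `L^p` function with unbounded pairings. -/
lemma exists_unbounded_pairing {p : ℝ≥0∞} (hp : 1 ≤ p) (u : ℕ → Torus → ℝ)
    (hu : ∀ n, Continuous (u n)) (b : ℕ → ℝ) (hb : ∀ n, 0 ≤ b n)
    (hup : ∀ n, eLpNorm (u n) p volume ≤ ENNReal.ofReal (b n))
    (hub : ∀ C : ℝ, ∃ n, C * b n < ∫ x, u n x ^ 2) :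
    ∃ g : Torus → ℝ, MemLp g p volume ∧ ∀ C : ℝ, ∃ n, C < |∫ x, g x * u n x| := by
  have hp' : Fact (1 ≤ p) := ⟨hp⟩
  have hconj := ENNReal.HolderConjugate.conjExponent hp
  have hq : Fact (1 ≤ ENNReal.conjExponent p) := ⟨le_self_add⟩
  have hmem : ∀ (r : ℝ≥0∞) (n : ℕ), MemLp (u n) r volume := by
    intro r n
    obtain ⟨c, hc⟩ := isCompact_univ.exists_bound_of_continuousOn (hu n).continuousOn
    exact MemLp.of_bound (hu n).aestronglyMeasurable c
      (Filter.Eventually.of_forall fun x => hc x (mem_univ x))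
  set Λ : ℕ → Lp ℝ p (volume : Measure Torus) →L[ℝ] ℝ := fun n =>
    ((ContinuousLinearMap.mul ℝ ℝ).lpPairing volume p (ENNReal.conjExponent p)).flip
      ((hmem _ n).toLp (u n)) with hΛ
  have hΛe : ∀ n (g : Lp ℝ p (volume : Measure Torus)), Λ n g = ∫ x, g x * u n x := by
    intro n g
    rw [hΛ, ContinuousLinearMap.flip_apply, ContinuousLinearMap.lpPairing_eq_integral]
    refine integral_congr_ae ?_
    filter_upwards [(hmem (ENNReal.conjExponent p) n).coeFn_toLp] with x hx
    rw [hx]; rfl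
  by_contra hcon
  push Not at hcon
  obtain ⟨C, hC⟩ := banach_steinhaus (g := Λ) fun g => by
    obtain ⟨C, hC⟩ := hcon g (Lp.memLp g)
    exact ⟨C, fun n => by rw [hΛe]; exact hC n⟩
  obtain ⟨n, hn⟩ := hub C
  -- Testing the functional on u_n itself gives ∫ u_n² ≤ C b_n, contrary to the hypothesis.
  have h1 := (Λ n).le_opNorm ((hmem p n).toLp (u n))
  have h2 : Λ n ((hmem p n).toLp (u n)) = ∫ x, u n x ^ 2 := by
    rw [hΛe]
    refine integral_congr_ae ?_
    filter_upwards [(hmem p n).coeFn_toLp] with x hx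
    rw [hx, sq]
  have h3 : ‖(hmem p n).toLp (u n)‖ ≤ b n := by
    rw [Lp.norm_toLp]
    exact ENNReal.toReal_le_of_le_ofReal (hb n) (hup n)
  rw [h2] at h1
  have h4 : ∫ x, u n x ^ 2 ≤ C * b n :=
    (le_abs_self _).trans (h1.trans (mul_le_mul (hC n) h3 (norm_nonneg _)
      ((norm_nonneg _).trans (hC n))))
  linarith

/-- After dividing by N^{-e}Q^e, the claim compares (C₁N/J)^{1-2e} with N^{-e}Q^{1-e} ≥ N^{1-2e}/4.
The powers of N cancel and J^{1-2e} remains. -/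
lemma wavePairing_lt {e C₁ C' N J Q : ℝ} (he : 0 ≤ e) (he2 : e < 1 / 2) (hC₁ : 0 < C₁) (hN : 0 < N)
    (hJ : 0 < J) (hQ : N / 4 ≤ Q) (hJC : 4 * |C'| * C₁ ^ (1 - 2 * e) < J ^ (1 - 2 * e)) :
    C' * (N ^ (-e) * ((C₁ * N / J) ^ (1 - 2 * e) * Q ^ e)) < (N ^ (-e)) ^ 2 * Q := by
  have hQ0 : 0 < Q := by linarith
  have h1 : N ^ (1 - e) / 4 ≤ Q ^ (1 - e) := by
    calc N ^ (1 - e) / 4 ≤ N ^ (1 - e) / 4 ^ (1 - e) := by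
          gcongr
          calc (4 : ℝ) ^ (1 - e) ≤ 4 ^ (1 : ℝ) :=
                Real.rpow_le_rpow_of_exponent_le (by norm_num) (by linarith)
            _ = 4 := Real.rpow_one _
      _ = (N / 4) ^ (1 - e) := (Real.div_rpow hN.le (by norm_num) _).symm
      _ ≤ _ := Real.rpow_le_rpow (by positivity) hQ (by linarith)
  have h2 : Q = Q ^ e * Q ^ (1 - e) := by
    rw [← Real.rpow_add hQ0]; simp
  have hJp : 0 < J ^ (1 - 2 * e) := by positivity
  have h3 : |C'| * (C₁ * N / J) ^ (1 - 2 * e) < N ^ (1 - 2 * e) / 4 := by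
    rw [Real.div_rpow (by positivity) hJ.le, Real.mul_rpow hC₁.le hN.le, ← mul_div_assoc,
      div_lt_div_iff₀ hJp (by norm_num)]
    have hNp : 0 < N ^ (1 - 2 * e) := by positivity
    calc _ = 4 * |C'| * C₁ ^ (1 - 2 * e) * N ^ (1 - 2 * e) := by ring
      _ < J ^ (1 - 2 * e) * N ^ (1 - 2 * e) := by gcongr
      _ = _ := mul_comm _ _
  have h4 : N ^ (1 - 2 * e) / 4 ≤ N ^ (-e) * Q ^ (1 - e) := by
    calc N ^ (1 - 2 * e) / 4 = N ^ (-e) * (N ^ (1 - e) / 4) := by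
          rw [← mul_div_assoc, ← Real.rpow_add hN]; congr 2; ring
      _ ≤ _ := by gcongr
  calc _ ≤ |C'| * (N ^ (-e) * ((C₁ * N / J) ^ (1 - 2 * e) * Q ^ e)) := by
        gcongr; exact le_abs_self _
    _ = N ^ (-e) * Q ^ e * (|C'| * (C₁ * N / J) ^ (1 - 2 * e)) := by ring
    _ < N ^ (-e) * Q ^ e * (N ^ (-e) * Q ^ (1 - e)) :=
        mul_lt_mul_of_pos_left (h3.trans_le h4) (by positivity)
    _ = (N ^ (-e)) ^ 2 * (Q ^ e * Q ^ (1 - e)) := by ring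
    _ = _ := by rw [← h2]

/-- Some `L^p` function has unbounded normalised pairings with the dispersed wave packets. -/
lemma exists_unbounded_wavePairing {β : ℝ} (hβ : 0 < β) (hβ' : β < 1) {p : ℝ≥0∞} (hp : 2 < p)
    (m : ℕ → ℕ) (t : ℕ → ℝ) (hm : ∀ J, 0 < J → 2 * J ^ 8 ≤ 2 ^ m J)
    (ht : ∀ J, 0 < J → t J * ((2 ^ m J : ℕ) : ℝ) ^ β = (J : ℝ) ^ 8) :
    ∃ g : Torus → ℝ, MemLp g p volume ∧ ∀ C : ℝ, ∃ n,
      C < ((2 ^ m (n + 1) : ℕ) : ℝ) ^ (-(p⁻¹).toReal) *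
        |∫ x, g x * evenWave β (2 ^ m (n + 1)) (t (n + 1)) x| := by
  obtain ⟨C₁, hC₁, hC⟩ := exists_evenWave_bounds hβ hβ'
  set e := (p⁻¹).toReal with he
  have he0 : 0 ≤ e := ENNReal.toReal_nonneg
  have he2 : e < 1 / 2 := toReal_inv_lt_half hp
  set N : ℕ → ℕ := fun n => 2 ^ m (n + 1) with hN
  set U : ℕ → Torus → ℝ := fun n => evenWave β (N n) (t (n + 1)) with hU
  have hN0 : ∀ n, (0 : ℝ) < N n := fun n => by simp only [hN]; positivity
  have hUc : ∀ n, Continuous (U n) := fun n => continuous_evenWave _ _ _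
  have hQ0 : ∀ n, 0 ≤ ∫ x, U n x ^ 2 := fun n => integral_nonneg fun x => sq_nonneg _
  -- Index n stands for J = n + 1, which keeps J positive. The bound b_n is the interpolated L^p
  -- norm, including the normalisation N^{-e}.
  obtain ⟨g, hg, hgu⟩ := exists_unbounded_pairing (one_le_two.trans hp.le)
    (fun n x => (N n : ℝ) ^ (-e) * U n x) (fun n => (hUc n).const_mul _)
    (fun n => (N n : ℝ) ^ (-e) * ((C₁ * N n / (n + 1 : ℕ)) ^ (1 - 2 * e) * (∫ x, U n x ^ 2) ^ e))
    (fun n => by have := hN0 n; have := hQ0 n; positivity)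
    (fun n => by
      have h1 := eLpNorm_le_of_abs_le hp (hUc n) (H := C₁ * N n / (n + 1 : ℕ))
        (by have := hN0 n; positivity)
        (hC (N n) (n + 1) (t (n + 1)) (by omega) (ht _ (by omega)) (hm _ (by omega))).1
      have h2 := eLpNorm_const_smul ((N n : ℝ) ^ (-e)) (U n) p (volume : Measure Torus)
      rw [ENNReal.ofReal_mul (by positivity)]
      refine (le_of_eq h2).trans ?_
      rw [Real.enorm_of_nonneg (by positivity)]
      gcongr)
    (fun C' => by
      have hlim : Filter.Tendsto (fun n : ℕ => ((n + 1 : ℕ) : ℝ)) Filter.atTop Filter.atTop :=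
        tendsto_natCast_atTop_atTop.comp (Filter.tendsto_add_atTop_nat 1)
      have hlim2 := (tendsto_rpow_atTop (by linarith : 0 < 1 - 2 * e)).comp hlim
      obtain ⟨n, hn1, hn2⟩ := ((hlim.eventually_ge_atTop C₁).and
        (hlim2.eventually_gt_atTop (4 * |C'| * C₁ ^ (1 - 2 * e)))).exists
      refine ⟨n, ?_⟩
      simp_rw [mul_pow]
      rw [integral_const_mul]
      exact wavePairing_lt he0 he2 hC₁ (hN0 n) (by positivity)
        ((hC (N n) (n + 1) (t (n + 1)) (by omega) (ht _ (by omega)) (hm _ (by omega))).2 hn1) hn2)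
  refine ⟨g, hg, fun C => ?_⟩
  obtain ⟨n, hn⟩ := hgu C
  refine ⟨n, hn.trans_eq ?_⟩
  rw [← abs_of_nonneg (by positivity : 0 ≤ ((2 ^ m (n + 1) : ℕ) : ℝ) ^ (-e)), ← abs_mul,
    ← integral_const_mul, abs_of_nonneg (by positivity : 0 ≤ ((2 ^ m (n + 1) : ℕ) : ℝ) ^ (-e))]
  congr 2
  ext x
  simp only [hU, hN]; ring

end DispersiveModel
end

/-! ### Conclusion: the normalised pairings are both bounded and unbounded. -/

theorem proposition6p3 (ψ : ℝ → ℝ) (hψ : DispersiveModel.IsCutoff ψ)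
    (α : ℝ) (hα₀ : 0 < α) (hα₁ : α < 1 / 2) (p : ℝ≥0∞) (hp : 2 < p) (δ : ℝ) (hδ : 0 < δ) :
    ∃ f₀ : DispersiveModel.Torus → ℝ, MemLp f₀ p volume ∧ (∀ x, f₀ (-x) = f₀ x) ∧
      ∀ (T : ℝ), 0 < T → ∀ E : DispersiveModel.ModelEquation,
        E.BarAssumption p δ T → E.ForcingAssumption ψ α p δ T →
        ∀ f : ℝ → DispersiveModel.L1, E.IsWeakSolution α T f₀ f →
          ∀ S : ℝ, 0 < S → S ≤ T → DispersiveModel.supLpNorm p S f = ⊤ := by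
  open DispersiveModel in
  have hp1 : 1 ≤ p := one_le_two.trans hp.le
  have hβ : 0 < 2 * α := by positivity
  choose m t hmt using fun J => exists_scale hβ hδ J
  obtain ⟨g, hg, hunb⟩ := exists_unbounded_wavePairing hβ (by linarith) hp m t
    (fun J hJ => (hmt J hJ).1) (fun J hJ => (hmt J hJ).2.2.1)
  obtain ⟨B, hB, hbound⟩ := exists_abs_integral_mul_wave_le hψ hα₀ hα₁ hp hδ
  refine ⟨fun x => g x + g (-x),
    hg.add (hg.comp_measurePreserving (Measure.measurePreserving_neg volume)),
    fun x => by simp only [neg_neg, add_comm], fun T hT E hbar hforce f hf S hS hST => ?_⟩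
  by_contra hne
  obtain ⟨C, t₀, ht₀, hC⟩ := hbar f hf.memLp_top ⟨S, hS, lt_top_iff_ne_top.2 hne⟩
  obtain ⟨F, hF⟩ := hforce
  set M := (supLpNorm p S f).toReal with hM
  have hfM : ∀ s ∈ Icc 0 S, eLpNorm (f s) p volume ≤ ENNReal.ofReal M := fun s hs => by
    rw [hM, ENNReal.ofReal_toReal hne]
    exact le_iSup₂ (f := fun s _ => eLpNorm (f s) p volume) s hs
  set a : ℕ → ℝ := fun n => ((2 ^ m (n + 1) : ℕ) : ℝ) ^ (-(p⁻¹).toReal) *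
    |∫ x, g x * evenWave (2 * α) (2 ^ m (n + 1)) (t (n + 1)) x| with ha
  have ha0 : ∀ n, 0 ≤ a n := fun n => by positivity
  -- For n ≥ n₁ the time t(n + 1) ≤ 1/(n + 1) lies below both S and t₀, so the `L^p` bound on f and
  -- the bound on f - f̄ hold during the whole life of the packet.
  obtain ⟨n₁, hn₁⟩ := exists_nat_one_div_lt (lt_min hS ht₀)
  have hle : ∀ n, n₁ ≤ n → a n ≤ B * (M + |C| + F) := by
    intro n hn
    obtain ⟨-, h2, h3, h4, h5, h6⟩ := hmt (n + 1) (by omega)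
    have htn : t (n + 1) ≤ min S t₀ := by
      refine h4.trans (le_trans ?_ hn₁.le)
      push_cast
      gcongr
    have htS := htn.trans (min_le_left _ _)
    have ht0 := htn.trans (min_le_right _ _)
    have h7 := hbound T hT E _ f hf M |C| F (m (n + 1)) (t (n + 1)) (((n + 1 : ℕ) : ℝ) ^ 8)
      ENNReal.toReal_nonneg (abs_nonneg C) h2 (htS.trans hST)
      (one_le_pow₀ (by exact_mod_cast Nat.succ_le_succ (Nat.zero_le n))) h3
      (fun s hs => hfM s ⟨hs.1, hs.2.trans htS⟩)
      (fun s hs => (hC s ⟨hs.1, hs.2.trans ht0⟩).trans (ENNReal.ofReal_le_ofReal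
        (mul_le_mul_of_nonneg_right (le_abs_self C) (Real.rpow_nonneg hs.1 δ)))) hF
    rw [integral_evenSum_mul hp1 hg (continuous_wave _ _ _ _)] at h7
    set R : ℝ := ((2 ^ m (n + 1) : ℕ) : ℝ) with hR
    have hR0 : 0 < R := by positivity
    calc a n ≤ R ^ (-(p⁻¹).toReal) * (B * R ^ (p⁻¹).toReal * (M + |C| * 1 + F * 1)) := by
          refine mul_le_mul_of_nonneg_left (h7.trans ?_) (by positivity)
          gcongr
      _ = R ^ (-(p⁻¹).toReal) * R ^ (p⁻¹).toReal * (B * (M + |C| + F)) := by ring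
      _ = _ := by rw [← Real.rpow_add hR0]; simp
  -- Unboundedness gives some n without forcing n ≥ n₁; adding the sum of the first n₁ terms to the
  -- threshold excludes the small indices too.
  obtain ⟨n, hn⟩ := hunb (B * (M + |C| + F) + ∑ k ∈ Finset.range n₁, a k)
  have hsum : 0 ≤ ∑ k ∈ Finset.range n₁, a k := Finset.sum_nonneg fun k _ => ha0 k
  have hBM : 0 ≤ B * (M + |C| + F) := by
    have : 0 ≤ M := ENNReal.toReal_nonneg
    positivity
  rcases le_or_gt n₁ n with h | h
  · have := hle n h
    simp only [ha] at this hsum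
    linarith
  · have := Finset.single_le_sum (fun k _ => ha0 k) (Finset.mem_range.2 h)
    simp only [ha] at this hsum hBM
    linarith
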